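/- All orders below are partial orders with field $\omega$, identified with sets of natural numbers through a computable pairing function. Let $\leq_P$ be such an order. Call $x$ \emph{small} if $x \leq_P y$ for all but finitely many $y$, \emph{large} if $y \leq_P x$ for all but finitely many $y$, and \emph{isolated} if $x$ is $\leq_P$-incomparable with all but finitely many $y$. The order $\leq_P$ is \emph{stable} if either every $x$ is small or isolated, or every $x$ is large or isolated; it is \emph{weakly stable} if every $x$ is small, isolated, or large. $\mathsf{SCAC}$ (respectively $\mathsf{WSCAC}$) is the problem whose instances are the stable (respectively weakly stable) partial orders, and whose solutions to a given instance are its infinite chains and its infinite antichains. A problem $\mathsf{P}$ is \emph{computably reducible} to a problem $\mathsf{Q}$, written $\mathsf{P} \leq_{\mathrm{c}} \mathsf{Q}$, if every instance $X$ of $\mathsf{P}$ computes an instance $\widehat{X}$ of $\mathsf{Q}$ such that for every solution $\widehat{Y}$ to $\widehat{X}$ there is a solution $Y$ to $X$ computable from $X \oplus \widehat{Y}$. Theorem. $\mathsf{WSCAC} \nleq_{\mathrm{c}} \mathsf{SCAC}$. Moreover, there is a weakly stable partial order $G$ which has no $G$-computable infinite chain or antichain, and such that every $G$-computable stable partial order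 with no $G$-computable infinite chain or antichain has an infinite chain $C$ and an infinite antichain $A$ for which at least one of $G \oplus C$ and $G \oplus A$ computes no infinite chain or antichain of $G$. -/

import Mathlib

namespace ChainAntichain

open scoped Computability

/-- The characteristic function of a set of natural numbers, as a (total) oracle. -/
noncomputable def charFn (X : Set ℕ) : ℕ →. ℕ :=
  fun n => Part.some (X.indicator (fun _ => 1) n)

/-- `X` is computable from `Y` (Turing reducibility of sets of natural numbers). -/
def ComputableFrom (X Y : Set ℕ) : Prop := charFn X ≤ᵀ charFn Y

/-- The Turing join `X ⊕ Y = {2k : k ∈ X} ∪ {2k + 1 : k ∈ Y}`. -/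
def join (X Y : Set ℕ) : Set ℕ :=
  (fun k => 2 * k) '' X ∪ (fun k => 2 * k + 1) '' Y

/-- A problem: a class of instances and, for each instance, its class of solutions. -/
structure Problem where
  /-- The instances. -/
  instances : Set (Set ℕ)
  /-- The solutions to a given instance. -/
  solutions : Set ℕ → Set (Set ℕ)

/-- `P ≤_c Q`: every instance `X` of `P` computes an instance `X'` of `Q` such that for every
solution `Y'` to `X'` there is a solution to `X` computable from `X ⊕ Y'`. -/
def ComputablyReducible (P Q : Problem) : Prop :=
  ∀ X ∈ P.instances, ∃ X' ∈ Q.instances, ComputableFrom X' X ∧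
    ∀ Y' ∈ Q.solutions X', ∃ Y ∈ P.solutions X, ComputableFrom Y (join X Y')

/-- The binary relation on `ℕ` coded by a set, through the bijective pairing `ℕ × ℕ → ℕ`. -/
def OrderRel (X : Set ℕ) (x y : ℕ) : Prop := Nat.pair x y ∈ X

/-- The set `X` codes a (reflexive) partial order with field `ℕ`. -/
def CodesPartialOrder (X : Set ℕ) : Prop :=
  (∀ x, OrderRel X x x) ∧ (∀ x y, OrderRel X x y → OrderRel X y x → x = y) ∧
    (∀ x y z, OrderRel X x y → OrderRel X y z → OrderRel X x z)

/-- `x` lies below almost every element. -/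
def IsSmall (r : ℕ → ℕ → Prop) (x : ℕ) : Prop := ∀ᶠ y in Filter.cofinite, r x y

/-- `x` lies above almost every element. -/
def IsLarge (r : ℕ → ℕ → Prop) (x : ℕ) : Prop := ∀ᶠ y in Filter.cofinite, r y x

/-- `x` is incomparable with almost every element. -/
def IsIsolated (r : ℕ → ℕ → Prop) (x : ℕ) : Prop := ∀ᶠ y in Filter.cofinite, ¬ r x y ∧ ¬ r y x

/-- `X` codes a stable partial order. -/
def StableOrder (X : Set ℕ) : Prop :=
  CodesPartialOrder X ∧
    ((∀ x, IsSmall (OrderRel X) x ∨ IsIsolated (OrderRel X) x) ∨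
      (∀ x, IsLarge (OrderRel X) x ∨ IsIsolated (OrderRel X) x))

/-- `X` codes a weakly stable partial order. -/
def WeaklyStableOrder (X : Set ℕ) : Prop :=
  CodesPartialOrder X ∧
    ∀ x, IsSmall (OrderRel X) x ∨ IsIsolated (OrderRel X) x ∨ IsLarge (OrderRel X) x

/-- `S` is an infinite chain of the order coded by `X`. -/
def InfChain (X S : Set ℕ) : Prop := S.Infinite ∧ IsChain (OrderRel X) S

/-- `S` is an infinite antichain of the order coded by `X`. -/
def InfAntichain (X S : Set ℕ) : Prop := S.Infinite ∧ IsAntichain (OrderRel X) S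

/-- The stable chain/antichain principle, as a problem. -/
def SCAC : Problem where
  instances := {X | StableOrder X}
  solutions X := {S | InfChain X S ∨ InfAntichain X S}

/-- The weakly stable chain/antichain principle, as a problem. -/
def WSCAC : Problem where
  instances := {X | WeaklyStableOrder X}
  solutions X := {S | InfChain X S ∨ InfAntichain X S}

/-- `Z` computes no infinite chain and no infinite antichain of the order coded by `X`. -/
def ComputesNoSolution (Z X : Set ℕ) : Prop :=
  ∀ S, InfChain X S ∨ InfAntichain X S → ¬ ComputableFrom S Z

end ChainAntichain

/-!
The order `G` is built by forcing. A condition (`Cond`) is a finite partial order whose elements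
carry promises to be small, large or isolated, and an extension (`Ext`) adds later elements that
respect the promises; so a generic `G` is weakly stable. The labels of the elements added by an
extension can be changed freely, within the consistency requirements of `Cond`, without changing the
order, and thus without changing the computations already decided. A pair of elements is killed if
it is comparable with an isolated member, or incomparable with a member that is not isolated; no
solution of `G` contains a killed pair. The combinatorial heart is `exists_relabel`: any *two* pairs
of new elements can be killed at the same time. In the critical case of a comparable and an
incomparable pair this needs all three labels, and it is what a stable order would not allow. With a
single pair it shows that `G` computes no solution of itself.

Let `Q` be a `G`-computable order in which every element is small or isolated, without
`G`-computable solutions; the case of large and isolated elements follows by reversing the order.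
Thinning (`exists_thin`) shows that every infinite set enumerable from `G` contains a small element,
since otherwise `G` would compute an antichain. An infinite set `C` of small elements and an
infinite set `A` of isolated elements are built by finite extension, and for each pair of
enumeration operators `Φ`, `Φ'` one ensures that `Φ` enumerates no solution from `G ⊕ C` or `Φ'`
none from `G ⊕ A` (`exists_secures`). Suppose one number `e` and two finite extensions are found, of
`C` by elements below `e` and of `A` by elements above `e`, on which `Φ` and `Φ'` each enumerate a
new pair. By relabelling and genericity, such a configuration occurs in `G` with both pairs killed.
If `e` is small, then so are the elements below it, and `C` may be extended; if `e` is isolated,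
then so are the elements above it, and `A` may be extended. If there is no such configuration, then
either almost no `e` bounds a suitable extension of `C`, and `Φ` enumerates only a finite set from
`G ⊕ C`; or infinitely many do, hence a small `e` does, and the lack of a suitable extension of `A`
above `e`, that is, among almost all numbers, makes `Φ'` enumerate only a finite set from `G ⊕ A`.
Finally `C` and `A` are thinned to a chain and an antichain.

Computability enters through the use principle `exists_isApprox`: sets computable from `Y` are
enumerated by monotone primitive recursive operators (`EnumOp`) on the initial segments of `Y`.
There are countably many of these, so that countably many dense sets suffice.
-/

namespace ChainAntichain

open scoped Computability

/-! ### Enumeration operators and the use principle -/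

open Classical in
/-- The initial segment of length `k` of the characteristic function of `Y`. -/
noncomputable def pref (Y : Set ℕ) (k : ℕ) : List Bool :=
  (List.range k).map fun i => decide (i ∈ Y)

@[simp] theorem length_pref (Y : Set ℕ) (k : ℕ) : (pref Y k).length = k := by simp [pref]

open Classical in
theorem pref_succ (Y : Set ℕ) (k : ℕ) : pref Y (k + 1) = pref Y k ++ [decide (k ∈ Y)] := by
  simp [pref, List.range_succ]

theorem pref_prefix (Y : Set ℕ) {k l : ℕ} (h : k ≤ l) : pref Y k <+: pref Y l := by
  induction l, h using Nat.le_induction with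
  | base => exact List.prefix_rfl
  | succ l _ ih => exact ih.trans (by rw [pref_succ]; exact List.prefix_append _ _)

open Classical in
theorem getElem?_pref (Y : Set ℕ) (k i : ℕ) :
    (pref Y k)[i]? = if i < k then some (decide (i ∈ Y)) else none := by
  by_cases h : i < k
  · simp [pref, h]
  · simp [pref, h]

theorem take_pref (Y : Set ℕ) {s k : ℕ} (h : s ≤ k) : (pref Y k).take s = pref Y s := by
  have := List.prefix_iff_eq_take.1 (pref_prefix Y h)
  rw [length_pref] at this
  exact this.symm

/-- An enumeration operator: a primitive recursive relation between finite oracle strings and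
numbers, monotone in the string. -/
structure EnumOp where
  /-- `rel σ x`: the operator enumerates `x` on the finite oracle `σ`. -/
  rel : List Bool → ℕ → Prop
  primrec : PrimrecRel rel
  mono : ∀ {σ τ : List Bool} {x : ℕ}, σ <+: τ → rel σ x → rel τ x

/-- The set enumerated by an operator from the oracle `Y`. -/
def EnumOp.enum (Φ : EnumOp) (Y : Set ℕ) : Set ℕ := {x | ∃ k, Φ.rel (pref Y k) x}

theorem EnumOp.rel_pref_mono (Φ : EnumOp) {Y : Set ℕ} {k l x : ℕ} (h : k ≤ l)
    (hx : Φ.rel (pref Y k) x) : Φ.rel (pref Y l) x := Φ.mono (pref_prefix Y h) hx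

instance : Countable EnumOp := by
  classical
  refine Function.Injective.countable (β := {f : ℕ → ℕ // Computable f})
    (f := fun Φ => ⟨fun n => if Φ.rel ((Encodable.decode (α := List Bool) n.unpair.1).getD [])
      n.unpair.2 then 1 else 0, ?_⟩) ?_
  · refine (Primrec.ite (Φ.primrec.comp ?_ ?_) (Primrec.const 1) (Primrec.const 0)).to_comp
    · exact Primrec.option_getD.comp (Primrec.decode.comp (Primrec.fst.comp Primrec.unpair))
        (Primrec.const [])
    · exact Primrec.snd.comp Primrec.unpair
  · intro Φ Ψ h
    have h' : Φ.rel = Ψ.rel := by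
      funext σ x
      have := congrFun (congrArg Subtype.val h) (Nat.pair (Encodable.encode σ) x)
      simp only [Nat.unpair_pair, Encodable.encodek, Option.getD_some] at this
      by_cases h1 : Φ.rel σ x <;> by_cases h2 : Ψ.rel σ x <;> simp_all
    cases Φ; cases Ψ; cases h'; rfl

/-- `g` approximates `f` along the initial segments of `Y`: it is a primitive recursive function of
a finite oracle string, and converging values persist when the string grows. -/
structure IsApprox (Y : Set ℕ) (f : ℕ →. ℕ) (g : List Bool → ℕ → Option ℕ) : Prop where
  primrec : Primrec₂ g
  mono : ∀ {σ τ : List Bool} {n v : ℕ}, σ <+: τ → g σ n = some v → g τ n = some v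
  mem_iff : ∀ n v, v ∈ f n ↔ ∃ k, g (pref Y k) n = some v

theorem IsApprox.pref_mono {Y : Set ℕ} {f : ℕ →. ℕ} {g : List Bool → ℕ → Option ℕ}
    (h : IsApprox Y f g) {k l n v : ℕ} (hkl : k ≤ l) (hk : g (pref Y k) n = some v) :
    g (pref Y l) n = some v := h.mono (pref_prefix Y hkl) hk

theorem IsApprox.of_total {Y : Set ℕ} {f : ℕ → ℕ} (hf : Primrec f) :
    IsApprox Y (fun n => Part.some (f n)) (fun _ n => some (f n)) where
  primrec := Primrec.option_some.comp (hf.comp Primrec.snd)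
  mono _ h := h
  mem_iff n v := by simp [eq_comm]

theorem IsApprox.oracle (Y : Set ℕ) :
    IsApprox Y (charFn Y) (fun σ n => (σ[n]?).map fun b => cond b 1 0) where
  primrec := Primrec.option_map (Primrec.list_getElem?.comp Primrec.fst Primrec.snd)
    (Primrec.cond Primrec.snd (Primrec.const 1) (Primrec.const 0))
  mono {σ τ n v} h hv := by
    obtain ⟨ρ, rfl⟩ := h
    simp only [Option.map_eq_some_iff] at hv ⊢
    obtain ⟨b, hb, rfl⟩ := hv
    refine ⟨b, ?_, rfl⟩
    obtain ⟨hlt, _⟩ := List.getElem?_eq_some_iff.1 hb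
    rw [List.getElem?_append_left hlt, hb]
  mem_iff n v := by
    classical
    simp only [charFn, Part.mem_some_iff, getElem?_pref]
    constructor
    · rintro rfl
      refine ⟨n + 1, ?_⟩
      by_cases h : n ∈ Y <;> simp [h]
    · rintro ⟨k, hk⟩
      split_ifs at hk with hlt
      · by_cases h : n ∈ Y <;> simp_all
      · simp at hk

theorem IsApprox.pair {Y : Set ℕ} {f h : ℕ →. ℕ} {g g' : List Bool → ℕ → Option ℕ}
    (hf : IsApprox Y f g) (hh : IsApprox Y h g') :
    IsApprox Y (fun n => Nat.pair <$> f n <*> h n)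
      (fun σ n => (g σ n).bind fun a => (g' σ n).map fun b => Nat.pair a b) where
  primrec := by
    refine Primrec.option_bind hf.primrec ?_
    refine Primrec.option_map (hh.primrec.comp (Primrec.fst.comp Primrec.fst)
      (Primrec.snd.comp Primrec.fst)) ?_
    exact Primrec₂.natPair.comp (Primrec.snd.comp Primrec.fst) Primrec.snd
  mono {σ τ n v} h hv := by
    simp only [Option.bind_eq_some_iff, Option.map_eq_some_iff] at hv ⊢
    obtain ⟨a, ha, b, hb, rfl⟩ := hv
    exact ⟨a, hf.mono h ha, b, hh.mono h hb, rfl⟩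
  mem_iff n v := by
    simp only [Option.bind_eq_some_iff, Option.map_eq_some_iff]
    constructor
    · intro hv
      simp only [Seq.seq, Part.map_eq_map, Part.mem_bind_iff, Part.mem_map_iff] at hv
      obtain ⟨_, ⟨a, ha, rfl⟩, b, hb, rfl⟩ := hv
      obtain ⟨k, hk⟩ := (hf.mem_iff _ _).1 ha
      obtain ⟨l, hl⟩ := (hh.mem_iff _ _).1 hb
      exact ⟨max k l, a, hf.pref_mono (le_max_left _ _) hk, b,
        hh.pref_mono (le_max_right _ _) hl, rfl⟩
    · rintro ⟨k, a, ha, b, hb, rfl⟩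
      simp only [Seq.seq, Part.map_eq_map, Part.mem_bind_iff, Part.mem_map_iff]
      exact ⟨_, ⟨a, (hf.mem_iff _ _).2 ⟨k, ha⟩, rfl⟩, b, (hh.mem_iff _ _).2 ⟨k, hb⟩, rfl⟩

theorem IsApprox.comp {Y : Set ℕ} {f h : ℕ →. ℕ} {g g' : List Bool → ℕ → Option ℕ}
    (hf : IsApprox Y f g) (hh : IsApprox Y h g') :
    IsApprox Y (fun n => h n >>= f) (fun σ n => (g' σ n).bind fun a => g σ a) where
  primrec := Primrec.option_bind hh.primrec
    (hf.primrec.comp (Primrec.fst.comp Primrec.fst) Primrec.snd)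
  mono {σ τ n v} h hv := by
    simp only [Option.bind_eq_some_iff] at hv ⊢
    obtain ⟨a, ha, hb⟩ := hv
    exact ⟨a, hh.mono h ha, hf.mono h hb⟩
  mem_iff n v := by
    refine Part.mem_bind_iff.trans ?_
    simp only [Option.bind_eq_some_iff]
    constructor
    · rintro ⟨a, ha, hb⟩
      obtain ⟨k, hk⟩ := (hh.mem_iff _ _).1 ha
      obtain ⟨l, hl⟩ := (hf.mem_iff _ _).1 hb
      exact ⟨max k l, a, hh.pref_mono (le_max_left _ _) hk, hf.pref_mono (le_max_right _ _) hl⟩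
    · rintro ⟨k, a, ha, hb⟩
      exact ⟨a, (hh.mem_iff _ _).2 ⟨k, ha⟩, (hf.mem_iff _ _).2 ⟨k, hb⟩⟩

theorem IsApprox.prec {Y : Set ℕ} {f h : ℕ →. ℕ} {g g' : List Bool → ℕ → Option ℕ}
    (hf : IsApprox Y f g) (hh : IsApprox Y h g') :
    IsApprox Y (fun p =>
        let (a, n) := Nat.unpair p
        n.rec (f a) fun y IH => do
          let i ← IH
          h (Nat.pair a (Nat.pair y i)))
      (fun σ p => Nat.rec (g σ p.unpair.1)
        (fun y IH => IH.bind fun i => g' σ (Nat.pair p.unpair.1 (Nat.pair y i))) p.unpair.2) where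
  primrec := by
    refine Primrec.nat_rec' (f := fun x : List Bool × ℕ => x.2.unpair.2)
      (g := fun x => g x.1 x.2.unpair.1)
      (h := fun x (q : ℕ × Option ℕ) =>
        q.2.bind fun i => g' x.1 (Nat.pair x.2.unpair.1 (Nat.pair q.1 i))) ?_ ?_ ?_
    · exact Primrec.snd.comp (Primrec.unpair.comp Primrec.snd)
    · exact hf.primrec.comp Primrec.fst (Primrec.fst.comp (Primrec.unpair.comp Primrec.snd))
    · refine Primrec.option_bind (Primrec.snd.comp Primrec.snd) ?_
      refine hh.primrec.comp (Primrec.fst.comp (Primrec.fst.comp Primrec.fst)) ?_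
      refine Primrec₂.natPair.comp (Primrec.fst.comp (Primrec.unpair.comp
        (Primrec.snd.comp (Primrec.fst.comp Primrec.fst)))) ?_
      exact Primrec₂.natPair.comp (Primrec.fst.comp (Primrec.snd.comp Primrec.fst)) Primrec.snd
  mono {σ τ p v} h hv := by
    revert hv
    generalize p.unpair.2 = n
    induction n generalizing v with
    | zero => exact hf.mono h
    | succ n ih =>
      intro hv
      simp only [Option.bind_eq_some_iff] at hv ⊢
      obtain ⟨a, ha, hb⟩ := hv
      exact ⟨a, ih ha, hh.mono h hb⟩
  mem_iff p v := by
    change v ∈ (Nat.rec (f p.unpair.1) (fun y IH => IH.bind fun i =>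
      h (Nat.pair p.unpair.1 (Nat.pair y i))) p.unpair.2 : Part ℕ) ↔ _
    generalize p.unpair.1 = a
    generalize p.unpair.2 = n
    induction n generalizing v with
    | zero => exact hf.mem_iff _ _
    | succ n ih =>
      simp only [Option.bind_eq_some_iff, Part.mem_bind_iff]
      constructor
      · rintro ⟨i, hi, hv⟩
        obtain ⟨k, hk⟩ := (ih _).1 hi
        obtain ⟨l, hl⟩ := (hh.mem_iff _ _).1 hv
        refine ⟨max k l, i, ?_, hh.pref_mono (le_max_right _ _) hl⟩
        clear ih hi hv hl
        induction n generalizing i with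
        | zero => exact hf.pref_mono (le_max_left _ _) hk
        | succ n ih =>
          simp only [Option.bind_eq_some_iff] at hk ⊢
          obtain ⟨j, hj, hk⟩ := hk
          exact ⟨j, ih _ hj, hh.pref_mono (le_max_left _ _) hk⟩
      · rintro ⟨k, i, hi, hv⟩
        exact ⟨i, (ih _).2 ⟨k, hi⟩, (hh.mem_iff _ _).2 ⟨k, hv⟩⟩

/-- Bounded minimisation of an approximation: take the first argument below the length of the
string at which the value is not visibly positive (the length itself if there is none), and return
it if the value there is zero. -/
def rfindApprox (g : List Bool → ℕ → Option ℕ) (σ : List Bool) (a : ℕ) : Option ℕ :=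
  let m := (List.range σ.length).findIdx fun i => decide ((g σ (Nat.pair a i)).getD 0 = 0)
  if g σ (Nat.pair a m) = some 0 then some m else none

theorem rfindApprox_eq_some {g : List Bool → ℕ → Option ℕ} {σ : List Bool} {a m : ℕ} :
    rfindApprox g σ a = some m ↔ m ≤ σ.length ∧ g σ (Nat.pair a m) = some 0 ∧
      ∀ j < m, ∃ w, w ≠ 0 ∧ g σ (Nat.pair a j) = some w := by
  have key : ∀ j, (g σ (Nat.pair a j)).getD 0 ≠ 0 ↔
      ∃ w, w ≠ 0 ∧ g σ (Nat.pair a j) = some w := by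
    intro j
    cases g σ (Nat.pair a j) <;> simp
  unfold rfindApprox
  simp only [← key]
  constructor
  · intro h
    split_ifs at h with h0
    cases h
    refine ⟨?_, h0, fun j hj => ?_⟩
    · simpa using List.findIdx_le_length (xs := List.range σ.length)
    · have := List.not_of_lt_findIdx hj
      simpa using this
  · rintro ⟨hm, h0, hj⟩
    have : (List.range σ.length).findIdx
        (fun i => decide ((g σ (Nat.pair a i)).getD 0 = 0)) = m := by
      rcases hm.lt_or_eq with hm | rfl
      · rw [List.findIdx_eq (by simpa using hm)]
        simp only [List.getElem_range, h0]
        exact ⟨by simp, fun j hjm => by simpa using hj j hjm⟩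
      · have := List.findIdx_eq_length (xs := List.range σ.length)
          (p := fun i => decide ((g σ (Nat.pair a i)).getD 0 = 0))
        rw [List.length_range] at this
        rw [this]
        intro x hx
        simpa using hj x (by simpa using hx)
    simp only [this, h0, if_true]

theorem IsApprox.rfind {Y : Set ℕ} {f : ℕ →. ℕ} {g : List Bool → ℕ → Option ℕ}
    (hf : IsApprox Y f g) :
    IsApprox Y (fun a => Nat.rfind fun n => (fun m => m = 0) <$> f (Nat.pair a n))
      (rfindApprox g) where
  primrec := by
    have hm : Primrec fun x : List Bool × ℕ => (List.range x.1.length).findIdx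
        fun i => decide ((g x.1 (Nat.pair x.2 i)).getD 0 = 0) := by
      refine Primrec.list_findIdx (Primrec.list_range.comp (Primrec.list_length.comp Primrec.fst)) ?_
      refine PrimrecPred.decide (p := fun y : (List Bool × ℕ) × ℕ =>
        (g y.1.1 (Nat.pair y.1.2 y.2)).getD 0 = 0) ?_
      refine Primrec.eq.comp (Primrec.option_getD.comp (hf.primrec.comp
        (Primrec.fst.comp Primrec.fst) (Primrec₂.natPair.comp (Primrec.snd.comp Primrec.fst)
          Primrec.snd)) (Primrec.const 0)) (Primrec.const 0)
    refine Primrec.ite (Primrec.eq.comp (hf.primrec.comp Primrec.fst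
      (Primrec₂.natPair.comp Primrec.snd hm)) (Primrec.const (some 0)))
      (Primrec.option_some.comp hm) (Primrec.const none)
  mono {σ τ n v} h hv := by
    rw [rfindApprox_eq_some] at hv ⊢
    refine ⟨hv.1.trans h.length_le, hf.mono h hv.2.1, fun j hj => ?_⟩
    obtain ⟨w, hw, hw'⟩ := hv.2.2 j hj
    exact ⟨w, hw, hf.mono h hw'⟩
  mem_iff n v := by
    refine Nat.mem_rfind.trans ?_
    simp only [rfindApprox_eq_some, Part.map_eq_map, Part.mem_map_iff, length_pref,
      decide_eq_true_eq, decide_eq_false_iff_not, exists_eq_right, hf.mem_iff]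
    constructor
    · rintro ⟨⟨k, hk⟩, hj⟩
      have : ∃ K, ∀ j < v, ∃ w, w ≠ 0 ∧ g (pref Y K) (Nat.pair n j) = some w := by
        clear hk
        induction v with
        | zero => exact ⟨0, by simp⟩
        | succ v ih =>
          obtain ⟨K, hK⟩ := ih fun {m} hm => hj (hm.trans (Nat.lt_succ_self _))
          obtain ⟨w, ⟨l, hl⟩, hw⟩ := hj (Nat.lt_succ_self v)
          refine ⟨max K l, fun j hjv => ?_⟩
          rcases Nat.lt_succ_iff_lt_or_eq.1 hjv with hjv | rfl
          · obtain ⟨w, hw, hw'⟩ := hK j hjv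
            exact ⟨w, hw, hf.pref_mono (le_max_left _ _) hw'⟩
          · exact ⟨w, hw, hf.pref_mono (le_max_right _ _) hl⟩
      obtain ⟨K, hK⟩ := this
      refine ⟨max v (max k K), le_max_left _ _, hf.pref_mono (by simp) hk, fun j hjv => ?_⟩
      obtain ⟨w, hw, hw'⟩ := hK j hjv
      exact ⟨w, hw, hf.pref_mono (by simp) hw'⟩
    · rintro ⟨k, _, hk, hj⟩
      refine ⟨⟨k, hk⟩, fun {j} hjv => ?_⟩
      obtain ⟨w, hw, hw'⟩ := hj j hjv
      exact ⟨w, ⟨k, hw'⟩, hw⟩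

/-- The use principle: a function recursive in `Y` is approximated along the initial segments of
`Y`. -/
theorem exists_isApprox {Y : Set ℕ} {f : ℕ →. ℕ} (hf : Nat.RecursiveIn {charFn Y} f) :
    ∃ g, IsApprox Y f g := by
  induction hf with
  | zero => exact ⟨_, .of_total (Primrec.const 0)⟩
  | succ => exact ⟨_, .of_total Primrec.succ⟩
  | left => exact ⟨_, .of_total (Primrec.fst.comp Primrec.unpair)⟩
  | right => exact ⟨_, .of_total (Primrec.snd.comp Primrec.unpair)⟩
  | oracle g hg => cases hg; exact ⟨_, .oracle Y⟩
  | pair _ _ ih₁ ih₂ =>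
    obtain ⟨_, h₁⟩ := ih₁
    obtain ⟨_, h₂⟩ := ih₂
    exact ⟨_, h₁.pair h₂⟩
  | comp _ _ ih₁ ih₂ =>
    obtain ⟨_, h₁⟩ := ih₁
    obtain ⟨_, h₂⟩ := ih₂
    exact ⟨_, h₁.comp h₂⟩
  | prec _ _ ih₁ ih₂ =>
    obtain ⟨_, h₁⟩ := ih₁
    obtain ⟨_, h₂⟩ := ih₂
    exact ⟨_, h₁.prec h₂⟩
  | rfind _ ih =>
    obtain ⟨_, h⟩ := ih
    exact ⟨_, h.rfind⟩

/-- The operator enumerating the arguments at which an approximation takes the value `v`. -/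
def IsApprox.toEnumOp {Y : Set ℕ} {f : ℕ →. ℕ} {g : List Bool → ℕ → Option ℕ}
    (h : IsApprox Y f g) (v : ℕ) : EnumOp where
  rel σ x := g σ x = some v
  primrec := Primrec.eq.comp h.primrec (Primrec.const _)
  mono := h.mono

/-- A set computable from `Y` is, together with its complement, enumerated from `Y`. -/
theorem ComputableFrom.exists_enum {X Y : Set ℕ} (h : ComputableFrom X Y) :
    ∃ Φ Ψ : EnumOp, Φ.enum Y = X ∧ Ψ.enum Y = Xᶜ := by
  obtain ⟨g, hg⟩ := exists_isApprox (RecursiveIn.iff_nat.1 h)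
  refine ⟨hg.toEnumOp 1, hg.toEnumOp 0, ?_, ?_⟩ <;> ext x <;>
    refine (hg.mem_iff x _).symm.trans ?_ <;> by_cases hx : x ∈ X <;> simp [charFn, hx]

/-! ### Computing sets from an oracle -/

/-- The total function `f` is recursive in the set `Y`. -/
def TotalIn (Y : Set ℕ) (f : ℕ → ℕ) : Prop :=
  Nat.RecursiveIn {charFn Y} fun n => Part.some (f n)

theorem TotalIn.of_primrec {Y : Set ℕ} {f : ℕ → ℕ} (hf : Primrec f) : TotalIn Y f :=
  (Primrec.nat_iff.1 hf).recursiveIn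

theorem TotalIn.comp {Y : Set ℕ} {f g : ℕ → ℕ} (hf : TotalIn Y f) (hg : TotalIn Y g) :
    TotalIn Y fun n => f (g n) :=
  (Nat.RecursiveIn.comp hf hg).of_eq fun n => by simp

theorem TotalIn.pair {Y : Set ℕ} {f g : ℕ → ℕ} (hf : TotalIn Y f) (hg : TotalIn Y g) :
    TotalIn Y fun n => Nat.pair (f n) (g n) :=
  (Nat.RecursiveIn.pair hf hg).of_eq fun n => by simp [Seq.seq]

open Classical in
theorem totalIn_indicator (Y : Set ℕ) : TotalIn Y fun n => if n ∈ Y then 1 else 0 :=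
  (Nat.RecursiveIn.oracle (charFn Y) (Set.mem_singleton _)).of_eq fun n => by
    by_cases h : n ∈ Y <;> simp [charFn, h]

theorem computableFrom_iff_totalIn {X Y : Set ℕ} :
    ComputableFrom X Y ↔ TotalIn Y (X.indicator fun _ => 1) :=
  RecursiveIn.iff_nat

/-- A function obtained by primitive recursion along a `Y`-recursive sequence `s` is `Y`-recursive.
The step `h` reads the stage, the value of `s` and the previous value, paired into one number. -/
theorem TotalIn.rec {Y : Set ℕ} {f s h : ℕ → ℕ} (hs : TotalIn Y s) (hh : Primrec h)
    (hf : ∀ k, f (k + 1) = h (Nat.pair k (Nat.pair (s k) (f k)))) : TotalIn Y f := by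
  have h1 : TotalIn Y fun m => h (Nat.pair m.unpair.2.unpair.1
      (Nat.pair (s m.unpair.2.unpair.1) m.unpair.2.unpair.2)) := by
    have hy : TotalIn Y fun m => m.unpair.2.unpair.1 := .of_primrec
      (Primrec.fst.comp (Primrec.unpair.comp (Primrec.snd.comp Primrec.unpair)))
    have hi : TotalIn Y fun m => m.unpair.2.unpair.2 := .of_primrec
      (Primrec.snd.comp (Primrec.unpair.comp (Primrec.snd.comp Primrec.unpair)))
    exact (TotalIn.of_primrec hh).comp (hy.pair ((hs.comp hy).pair hi))
  have h2 := Nat.RecursiveIn.prec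
    (TotalIn.of_primrec (Y := Y) (Primrec.const (f 0))) h1
  have h3 : TotalIn Y fun k => Nat.pair 0 k :=
    .of_primrec (Primrec₂.natPair.comp (Primrec.const 0) Primrec.id)
  refine (Nat.RecursiveIn.comp h2 h3).of_eq fun n => ?_
  simp only [Part.bind_eq_bind, Part.bind_some, Nat.unpair_pair]
  induction n with
  | zero => rfl
  | succ n ih => simp only [ih, Part.bind_some, hf]

/-- Iterating a primitive recursive step along a `Y`-recursive sequence is `Y`-recursive. -/
theorem TotalIn.encode_rec {α β : Type*} [Primcodable α] [Primcodable β] {Y : Set ℕ}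
    {t : ℕ → α} {s : ℕ → β} {h : ℕ → β → α → α} (hs : TotalIn Y fun k => Encodable.encode (s k))
    (hh : Primrec fun x : ℕ × β × α => h x.1 x.2.1 x.2.2)
    (ht : ∀ k, t (k + 1) = h k (s k) (t k)) : TotalIn Y fun k => Encodable.encode (t k) := by
  refine TotalIn.rec (h := fun m => Encodable.encode
    (h m.unpair.1 ((Encodable.decode m.unpair.2.unpair.1).getD (s 0))
      ((Encodable.decode m.unpair.2.unpair.2).getD (t 0)))) hs ?_ ?_
  · have h2 : Primrec fun m : ℕ => m.unpair.2.unpair :=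
      Primrec.unpair.comp (Primrec.snd.comp Primrec.unpair)
    exact Primrec.encode.comp (hh.comp (Primrec.pair (Primrec.fst.comp Primrec.unpair)
      (Primrec.pair
        (Primrec.option_getD.comp (Primrec.decode.comp (Primrec.fst.comp h2)) (Primrec.const _))
        (Primrec.option_getD.comp (Primrec.decode.comp (Primrec.snd.comp h2))
          (Primrec.const _)))))
  · intro k
    simp [ht]

theorem totalIn_pref (Y : Set ℕ) : TotalIn Y fun k => Encodable.encode (pref Y k) := by
  classical
  refine TotalIn.encode_rec (h := fun _ (b : ℕ) σ => σ ++ [decide (b = 1)])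
    (s := fun n => if n ∈ Y then 1 else 0) (totalIn_indicator Y) ?_ ?_
  · exact Primrec.list_concat.comp (Primrec.snd.comp Primrec.snd)
      ((Primrec.eq.comp (Primrec.fst.comp Primrec.snd) (Primrec.const 1)).decide)
  · intro k
    rw [pref_succ]
    by_cases h : k ∈ Y <;> simp [h]

/-- If membership in `X` and in its complement both become visible, primitive recursively, along a
`Y`-recursive sequence, then `X` is computable from `Y`. -/
theorem computableFrom_of_seq {α : Type*} [Primcodable α] {X Y : Set ℕ} {t : ℕ → α}
    (ht : TotalIn Y fun k => Encodable.encode (t k)) {A B : α → ℕ → Prop}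
    (hA : PrimrecRel A) (hB : PrimrecRel B) (hX : ∀ n, n ∈ X ↔ ∃ k, A (t k) n)
    (hX' : ∀ n, n ∉ X ↔ ∃ k, B (t k) n) : ComputableFrom X Y := by
  classical
  have hdec : Primrec fun m : ℕ => (Encodable.decode (α := α) m.unpair.2).getD (t 0) :=
    Primrec.option_getD.comp (Primrec.decode.comp (Primrec.snd.comp Primrec.unpair))
      (Primrec.const _)
  have hfst : Primrec fun m : ℕ => m.unpair.1 := Primrec.fst.comp Primrec.unpair
  have hpair : TotalIn Y fun m => Nat.pair m.unpair.1 (Encodable.encode (t m.unpair.2)) :=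
    (TotalIn.of_primrec hfst).pair
      (ht.comp (.of_primrec (Primrec.snd.comp Primrec.unpair)))
  have hu : TotalIn Y fun m => if A (t m.unpair.2) m.unpair.1 ∨ B (t m.unpair.2) m.unpair.1
      then 0 else 1 := by
    have := (TotalIn.of_primrec (Y := Y) (Primrec.ite ((hA.comp hdec hfst).or (hB.comp hdec hfst))
      (Primrec.const 0) (Primrec.const 1))).comp hpair
    simpa using this
  have hv : TotalIn Y fun m => if A (t m.unpair.2) m.unpair.1 then 1 else 0 := by
    have := (TotalIn.of_primrec (Y := Y) (Primrec.ite (hA.comp hdec hfst)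
      (Primrec.const 1) (Primrec.const 0))).comp hpair
    simpa using this
  have hex : ∀ n, ∃ k, A (t k) n ∨ B (t k) n := by
    intro n
    by_cases h : n ∈ X
    · obtain ⟨k, hk⟩ := (hX n).1 h
      exact ⟨k, .inl hk⟩
    · obtain ⟨k, hk⟩ := (hX' n).1 h
      exact ⟨k, .inr hk⟩
  -- the least stage at which membership or non-membership becomes visible
  have hfind : TotalIn Y fun n => Nat.find (hex n) := by
    refine (Nat.RecursiveIn.rfind hu).of_eq fun n => Part.eq_some_iff.2 (Nat.mem_rfind.2 ?_)
    simp only [Nat.unpair_pair, Part.map_eq_map, Part.map_some, Part.mem_some_iff]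
    refine ⟨?_, fun {m} hm => ?_⟩
    · simp [Nat.find_spec (hex n)]
    · simp [Nat.find_min (hex n) hm]
  have key := hv.comp ((TotalIn.of_primrec Primrec.id).pair hfind)
  rw [computableFrom_iff_totalIn]
  convert key using 2 with n
  simp only [Nat.unpair_pair, id]
  by_cases h : n ∈ X
  · have h1 : ¬ ∃ k, B (t k) n := fun hk => (hX' n).2 hk h
    have h2 := (Nat.find_spec (hex n)).resolve_right fun hk => h1 ⟨_, hk⟩
    simp [h, h2]
  · have h1 : ¬ ∃ k, A (t k) n := fun hk => h ((hX n).2 hk)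
    have h2 : ¬ A (t (Nat.find (hex n))) n := fun hk => h1 ⟨_, hk⟩
    simp [h, h2]

theorem ComputableFrom.trans {X Y Z : Set ℕ} (h : ComputableFrom X Y) (h' : ComputableFrom Y Z) :
    ComputableFrom X Z := TuringReducible.trans h h'

theorem ComputableFrom.comp {X Y : Set ℕ} (h : ComputableFrom X Y) {f : ℕ → ℕ} (hf : Primrec f) :
    ComputableFrom (f ⁻¹' X) Y :=
  computableFrom_iff_totalIn.2 ((computableFrom_iff_totalIn.1 h).comp (.of_primrec hf))

theorem mem_join_two_mul {X Y : Set ℕ} {k : ℕ} : 2 * k ∈ join X Y ↔ k ∈ X := by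
  simp only [join, Set.mem_union, Set.mem_image]
  constructor
  · rintro (⟨l, hl, h⟩ | ⟨l, hl, h⟩)
    · rwa [show k = l by omega]
    · omega
  · exact fun h => .inl ⟨k, h, rfl⟩

theorem mem_join_two_mul_add_one {X Y : Set ℕ} {k : ℕ} : 2 * k + 1 ∈ join X Y ↔ k ∈ Y := by
  simp only [join, Set.mem_union, Set.mem_image]
  constructor
  · rintro (⟨l, hl, h⟩ | ⟨l, hl, h⟩)
    · omega
    · rwa [show k = l by omega]
  · exact fun h => .inr ⟨k, h, rfl⟩

theorem mem_join {X Y : Set ℕ} {i : ℕ} :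
    i ∈ join X Y ↔ if i % 2 = 0 then i / 2 ∈ X else i / 2 ∈ Y := by
  split_ifs with h
  · rw [← mem_join_two_mul (X := X) (Y := Y), show 2 * (i / 2) = i by omega]
  · rw [← mem_join_two_mul_add_one (X := X) (Y := Y), show 2 * (i / 2) + 1 = i by omega]

theorem computableFrom_join_left (X Y : Set ℕ) : ComputableFrom X (join X Y) := by
  have := ComputableFrom.comp (X := join X Y) (TuringReducible.refl _) (f := fun n => 2 * n)
    (Primrec.nat_mul.comp (Primrec.const 2) Primrec.id)
  convert this using 1
  ext k
  exact mem_join_two_mul.symm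

theorem computableFrom_join_right (X Y : Set ℕ) : ComputableFrom Y (join X Y) := by
  have := ComputableFrom.comp (X := join X Y) (TuringReducible.refl _) (f := fun n => 2 * n + 1)
    (Primrec.succ.comp (Primrec.nat_mul.comp (Primrec.const 2) Primrec.id))
  convert this using 1
  ext k
  exact mem_join_two_mul_add_one.symm

theorem ComputableFrom.join {X Y Z : Set ℕ} (hX : ComputableFrom X Z) (hY : ComputableFrom Y Z) :
    ComputableFrom (join X Y) Z := by
  classical
  rw [computableFrom_iff_totalIn] at *
  have hdiv : TotalIn Z fun n => n / 2 :=
    .of_primrec (Primrec.nat_div.comp Primrec.id (Primrec.const 2))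
  have hp : Primrec fun m : ℕ => if m.unpair.1 % 2 = 0 then m.unpair.2.unpair.1
      else m.unpair.2.unpair.2 := by
    have h2 : Primrec fun m : ℕ => m.unpair.2.unpair :=
      Primrec.unpair.comp (Primrec.snd.comp Primrec.unpair)
    exact Primrec.ite (Primrec.eq.comp (Primrec.nat_mod.comp (Primrec.fst.comp Primrec.unpair)
      (Primrec.const 2)) (Primrec.const 0)) (Primrec.fst.comp h2) (Primrec.snd.comp h2)
  have := (TotalIn.of_primrec hp).comp ((TotalIn.of_primrec Primrec.id).pair
    ((hX.comp hdiv).pair (hY.comp hdiv)))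
  convert this using 2 with n
  simp only [Set.indicator_apply, mem_join, Nat.unpair_pair, id]
  split_ifs <;> rfl

/-- A set is enumerable from `Y` if a primitive recursive condition on an initial segment of `Y`
and a further witness defines it. -/
theorem exists_enum_of_witness {β : Type*} [Primcodable β] [Inhabited β]
    {K : List Bool → ℕ → β → Prop}
    (hK : PrimrecPred fun x : List Bool × ℕ × β => K x.1 x.2.1 x.2.2) :
    ∃ Φ : EnumOp, ∀ Y : Set ℕ, Φ.enum Y = {x | ∃ k w, K (pref Y k) x w} := by
  let d : ℕ → β := fun m => (Encodable.decode m).getD default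
  have hd : Primrec d := Primrec.option_getD.comp Primrec.decode (Primrec.const _)
  refine ⟨⟨fun σ x => ∃ s < σ.length + 1, ∃ m < σ.length, K (σ.take s) x (d m), ?_, ?_⟩, ?_⟩
  -- bounding both the length of the initial segment and the witness by the length of `σ` makes
  -- the relation primitive recursive and monotone
  · have h1 : PrimrecRel fun (m : ℕ) (y : ℕ × List Bool × ℕ) => K (y.2.1.take y.1) y.2.2 (d m) := by
      have hy : Primrec fun z : ℕ × ℕ × List Bool × ℕ => z.2.2 := Primrec.snd.comp Primrec.snd
      refine hK.comp (Primrec.pair (Primrec.list_take.comp (Primrec.fst.comp Primrec.snd)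
        (Primrec.fst.comp hy)) (Primrec.pair (Primrec.snd.comp hy) (hd.comp Primrec.fst)))
    have h2 : PrimrecRel fun (s : ℕ) (y : List Bool × ℕ) =>
        ∃ m < y.1.length, K (y.1.take s) y.2 (d m) :=
      ((h1.exists_mem_list.comp (Primrec.list_range.comp
        (Primrec.list_length.comp (Primrec.fst.comp Primrec.snd))) Primrec.id).of_eq
        fun y => by simp)
    exact ((h2.exists_mem_list.comp (Primrec.list_range.comp
      (Primrec.succ.comp (Primrec.list_length.comp Primrec.fst))) Primrec.id).of_eq
        fun y => by simp)
  · rintro σ τ x ⟨ρ, rfl⟩ ⟨s, hs, m, hm, h⟩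
    refine ⟨s, ?_, m, ?_, ?_⟩
    · simp only [List.length_append]; omega
    · simp only [List.length_append]; omega
    · rwa [List.take_append_of_le_length (by omega)]
  · intro Y
    ext x
    constructor
    · rintro ⟨k, s, hs, m, -, h⟩
      rw [length_pref] at hs
      rw [take_pref Y (by omega)] at h
      exact ⟨s, _, h⟩
    · rintro ⟨k, w, h⟩
      refine ⟨max k (Encodable.encode w + 1), k, ?_, Encodable.encode w, ?_, ?_⟩
      · rw [length_pref]; omega
      · rw [length_pref]; omega
      · rw [take_pref Y (le_max_left _ _)]
        simpa [d] using h

/-! ### Thinning -/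

/-- The greedy thinning of the set enumerated by `Φ` into a descending list whose elements are
pairwise in the relation enumerated by `Θ`; stage `k` considers the candidate `k.unpair.1`. -/
noncomputable def thin (Φ Θ : EnumOp) (Y : Set ℕ) : ℕ → List ℕ
  | 0 => []
  | k + 1 =>
    open Classical in
    if Φ.rel (pref Y k) k.unpair.1 ∧ (∀ y ∈ thin Φ Θ Y k, y < k.unpair.1) ∧
        ∀ y ∈ thin Φ Θ Y k, Θ.rel (pref Y k) (Nat.pair y k.unpair.1)
    then k.unpair.1 :: thin Φ Θ Y k else thin Φ Θ Y k

section thin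

variable (Φ Θ : EnumOp) (Y : Set ℕ)

theorem totalIn_thin : TotalIn Y fun k => Encodable.encode (thin Φ Θ Y k) := by
  classical
  refine TotalIn.encode_rec (s := fun k => pref Y k)
    (h := fun k σ L => if Φ.rel σ k.unpair.1 ∧ (∀ y ∈ L, y < k.unpair.1) ∧
        ∀ y ∈ L, Θ.rel σ (Nat.pair y k.unpair.1) then k.unpair.1 :: L else L)
    (totalIn_pref Y) ?_ (fun k => by rw [thin])
  have hx : Primrec fun z : ℕ × List Bool × List ℕ => z.1.unpair.1 :=
    Primrec.fst.comp (Primrec.unpair.comp Primrec.fst)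
  have hσ : Primrec fun z : ℕ × List Bool × List ℕ => z.2.1 := Primrec.fst.comp Primrec.snd
  have hL : Primrec fun z : ℕ × List Bool × List ℕ => z.2.2 := Primrec.snd.comp Primrec.snd
  have h1 : PrimrecRel fun (y : ℕ) (p : List Bool × ℕ) => Θ.rel p.1 (Nat.pair y p.2) :=
    Θ.primrec.comp (Primrec.fst.comp Primrec.snd)
      (Primrec₂.natPair.comp Primrec.fst (Primrec.snd.comp Primrec.snd))
  refine Primrec.ite ((Φ.primrec.comp hσ hx).and
    ((Primrec.nat_lt.forall_mem_list.comp hL hx).and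
      (h1.forall_mem_list.comp hL (Primrec.pair hσ hx)))) (Primrec.list_cons.comp hx hL) hL

variable {Φ Θ Y}

theorem thin_suffix_succ (k : ℕ) : thin Φ Θ Y k <:+ thin Φ Θ Y (k + 1) := by
  rw [thin]
  split_ifs
  · exact List.suffix_cons _ _
  · exact List.suffix_rfl

theorem thin_suffix {k l : ℕ} (h : k ≤ l) : thin Φ Θ Y k <:+ thin Φ Θ Y l := by
  induction l, h using Nat.le_induction with
  | base => exact List.suffix_rfl
  | succ l _ ih => exact ih.trans (thin_suffix_succ l)

theorem pairwise_thin (k : ℕ) :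
    (thin Φ Θ Y k).Pairwise fun x y => y < x ∧ Nat.pair y x ∈ Θ.enum Y := by
  induction k with
  | zero => simp [thin]
  | succ k ih =>
    rw [thin]
    split_ifs with h
    · exact List.pairwise_cons.2 ⟨fun y hy => ⟨h.2.1 y hy, k, h.2.2 y hy⟩, ih⟩
    · exact ih

theorem thin_subset (k : ℕ) : ∀ x ∈ thin Φ Θ Y k, x ∈ Φ.enum Y := by
  induction k with
  | zero => simp [thin]
  | succ k ih =>
    rw [thin]
    split_ifs with h
    · intro x hx
      rcases List.mem_cons.1 hx with rfl | hx
      · exact ⟨k, h.1⟩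
      · exact ih x hx
    · exact ih

end thin

/-- Thinning: if every element of an infinite set enumerated from `Y` is, for almost every `y`, in a
relation enumerated from `Y`, then `Y` computes an infinite subset homogeneous for the relation. -/
theorem exists_thin {Y : Set ℕ} (Φ Θ : EnumOp) (hinf : (Φ.enum Y).Infinite)
    (hlim : ∀ x ∈ Φ.enum Y, ∀ᶠ y in Filter.cofinite, Nat.pair x y ∈ Θ.enum Y) :
    ∃ S ⊆ Φ.enum Y, S.Infinite ∧ ComputableFrom S Y ∧
      ∀ x ∈ S, ∀ y ∈ S, x < y → Nat.pair x y ∈ Θ.enum Y := by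
  set S : Set ℕ := {x | ∃ k, x ∈ thin Φ Θ Y k} with hS
  have hsub : S ⊆ Φ.enum Y := fun x ⟨k, hk⟩ => thin_subset k x hk
  have hpair : ∀ {k x y}, x ∈ thin Φ Θ Y k → y ∈ thin Φ Θ Y k → x < y →
      Nat.pair x y ∈ Θ.enum Y := by
    intro k x y hx hy hxy
    have h1 := pairwise_thin (Φ := Φ) (Θ := Θ) (Y := Y) k
    refine List.Pairwise.forall_of_forall_of_flip (l := thin Φ Θ Y k)
      (R := fun a b => a < b → Nat.pair a b ∈ Θ.enum Y) (fun a _ h => absurd h (lt_irrefl a))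
      (h1.imp fun h h' => absurd h' (Nat.lt_asymm h.1)) (h1.imp fun h _ => h.2) hx hy hxy
  have hSinf : S.Infinite := by
    intro hfin
    obtain ⟨n, hn⟩ := hfin.bddAbove
    have hev : ∀ᶠ y in Filter.cofinite, ∀ x ∈ S, Nat.pair x y ∈ Θ.enum Y :=
      (Filter.eventually_all_finite hfin).2 fun x hx => hlim x (hsub hx)
    have hgt : ∀ᶠ y in Filter.cofinite, n < y :=
      (Set.finite_Iic n).subset fun y hy => Set.mem_Iic.2 (not_lt.1 hy)
    -- were the thinned set bounded by `n`, some `y > n` of the enumerated set would be compatible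
    -- with all of it, and would be added at the stages that consider `y` late enough
    obtain ⟨y, hyM, hy, hny⟩ :=
      ((Filter.frequently_cofinite_mem_iff_infinite.2 hinf).and_eventually (hev.and hgt)).exists
    have hstage : ∀ᶠ k in Filter.atTop, Φ.rel (pref Y k) y ∧
        ∀ x ∈ S, Θ.rel (pref Y k) (Nat.pair x y) := by
      refine Filter.Eventually.and ?_ ((Filter.eventually_all_finite hfin).2 fun x hx => ?_)
      · obtain ⟨k, hk⟩ := hyM
        exact Filter.eventually_atTop.2 ⟨k, fun l hl => Φ.rel_pref_mono hl hk⟩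
      · obtain ⟨k, hk⟩ := hy x hx
        exact Filter.eventually_atTop.2 ⟨k, fun l hl => Θ.rel_pref_mono hl hk⟩
    obtain ⟨K, hK⟩ := Filter.eventually_atTop.1 hstage
    obtain ⟨h1, h2⟩ := hK (Nat.pair y K) (Nat.right_le_pair y K)
    have hyS : y ∈ S := by
      refine ⟨Nat.pair y K + 1, ?_⟩
      rw [thin, Nat.unpair_pair, if_pos]
      · exact List.mem_cons_self
      · exact ⟨h1, fun x hx => (hn ⟨_, hx⟩).trans_lt hny, fun x hx => h2 x ⟨_, hx⟩⟩
    exact absurd (hn hyS) (not_le.2 hny)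
  refine ⟨S, hsub, hSinf, ?_, ?_⟩
  · refine computableFrom_of_seq (totalIn_thin Φ Θ Y) (A := fun L x => x ∈ L)
      (B := fun L x => x ∉ L ∧ ∃ y ∈ L, x < y) ?_ ?_ (fun n => Iff.rfl) ?_
    · exact (Primrec.eq.exists_mem_list (α := ℕ)).of_eq fun L x => by simp
    · exact ((Primrec.eq.exists_mem_list (α := ℕ)).of_eq (s := fun L x => x ∈ L)
        fun L x => by simp).not.and (Primrec.nat_lt.swap.exists_mem_list)
    · intro n
      constructor
      · intro hn
        obtain ⟨y, ⟨k, hk⟩, hy⟩ := hSinf.exists_gt n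
        exact ⟨k, fun h => hn ⟨k, h⟩, y, hk, hy⟩
      · rintro ⟨k, hk, y, hy, hny⟩ ⟨l, hl⟩
        rcases le_total l k with h | h
        · exact hk ((thin_suffix h).subset hl)
        · -- elements enter the list in increasing order
          obtain ⟨L, hL⟩ := thin_suffix (Φ := Φ) (Θ := Θ) (Y := Y) h
          have hpw := pairwise_thin (Φ := Φ) (Θ := Θ) (Y := Y) l
          rw [← hL] at hl hpw
          rcases List.mem_append.1 hl with hl | hl
          · exact Nat.lt_asymm hny ((List.pairwise_append.1 hpw).2.2 n hl y hy).1
          · exact hk hl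
  · rintro x ⟨k, hk⟩ y ⟨l, hl⟩ hxy
    exact hpair ((thin_suffix (le_max_left k l)).subset hk)
      ((thin_suffix (le_max_right k l)).subset hl) hxy

/-! ### Forcing weakly stable orders -/

/-- A forcing condition: a partial order on `{x | x < n}` together with a promise, for each of its
elements, to be below (`sm`), above (`lg`), or otherwise incomparable with all later elements. Only
the values below `n` matter. -/
structure Cond where
  /-- The size of the field. -/
  n : ℕ
  /-- The order. -/
  r : ℕ → ℕ → Prop
  /-- The elements promised to be small. -/
  sm : ℕ → Prop
  /-- The elements promised to be large. -/
  lg : ℕ → Prop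
  refl : ∀ x < n, r x x
  antisymm : ∀ x < n, ∀ y < n, r x y → r y x → x = y
  trans : ∀ x < n, ∀ y < n, ∀ z < n, r x y → r y z → r x z
  sm_down : ∀ x < n, ∀ y < n, r x y → sm y → sm x
  lg_up : ∀ x < n, ∀ y < n, r x y → lg x → lg y
  sm_lg : ∀ x < n, ∀ y < n, sm x → lg y → r x y
  disj : ∀ x < n, sm x → ¬ lg x

/-- `Ext q p`: the condition `q` extends `p` and keeps its promises. -/
structure Ext (q p : Cond) : Prop where
  le : p.n ≤ q.n
  r_iff : ∀ x < p.n, ∀ y < p.n, (q.r x y ↔ p.r x y)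
  sm_iff : ∀ x < p.n, (q.sm x ↔ p.sm x)
  lg_iff : ∀ x < p.n, (q.lg x ↔ p.lg x)
  new_sm : ∀ x < p.n, ∀ y < q.n, p.n ≤ y → (q.r x y ↔ p.sm x)
  new_lg : ∀ x < p.n, ∀ y < q.n, p.n ≤ y → (q.r y x ↔ p.lg x)

theorem Ext.rfl {p : Cond} : Ext p p where
  le := le_rfl
  r_iff _ _ _ _ := Iff.rfl
  sm_iff _ _ := Iff.rfl
  lg_iff _ _ := Iff.rfl
  new_sm _ _ _ h h' := absurd h (not_lt.2 h')
  new_lg _ _ _ h h' := absurd h (not_lt.2 h')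

theorem Ext.trans {s q p : Cond} (h : Ext s q) (h' : Ext q p) : Ext s p := by
  obtain ⟨a1, a2, a3, a4, a5, a6⟩ := h
  obtain ⟨b1, b2, b3, b4, b5, b6⟩ := h'
  constructor <;> grind

/-- The extension by one new element, promised to be isolated. -/
def Cond.succ (p : Cond) : Cond where
  n := p.n + 1
  r x y := (x < p.n ∧ y < p.n ∧ p.r x y) ∨ (x < p.n ∧ y = p.n ∧ p.sm x) ∨
    (x = p.n ∧ y < p.n ∧ p.lg y) ∨ (x = p.n ∧ y = p.n)
  sm x := x < p.n ∧ p.sm x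
  lg x := x < p.n ∧ p.lg x
  refl := by have := p.refl; grind
  antisymm := by have := p.antisymm; have := p.disj; grind
  trans := by
    have := p.trans; have := p.sm_down; have := p.lg_up; have := p.sm_lg; have := p.disj
    grind
  sm_down := by have := p.sm_down; have := p.disj; grind
  lg_up := by have := p.lg_up; have := p.disj; grind
  sm_lg := by have := p.sm_lg; grind
  disj := by have := p.disj; grind

theorem Cond.ext_succ (p : Cond) : Ext p.succ p := by
  constructor <;> simp only [Cond.succ] <;> grind

/-- The set `G` codes a relation extending the condition `q` and keeping its promises. -/
structure Below (G : Set ℕ) (q : Cond) : Prop where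
  r_iff : ∀ x < q.n, ∀ y < q.n, (OrderRel G x y ↔ q.r x y)
  sm_iff : ∀ x < q.n, ∀ y, q.n ≤ y → (OrderRel G x y ↔ q.sm x)
  lg_iff : ∀ x < q.n, ∀ y, q.n ≤ y → (OrderRel G y x ↔ q.lg x)

theorem Below.ext {G : Set ℕ} {p q : Cond} (hp : Below G p) (hq : Below G q) (h : p.n ≤ q.n) :
    Ext q p where
  le := h
  r_iff x hx y hy := by rw [← hp.r_iff x hx y hy, hq.r_iff x (by omega) y (by omega)]
  sm_iff x hx := by rw [← hp.sm_iff x hx q.n h, hq.sm_iff x (by omega) q.n le_rfl]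
  lg_iff x hx := by rw [← hp.lg_iff x hx q.n h, hq.lg_iff x (by omega) q.n le_rfl]
  new_sm x hx y hy hy' := by rw [← hp.sm_iff x hx y hy', hq.r_iff x (by omega) y hy]
  new_lg x hx y hy hy' := by rw [← hp.lg_iff x hx y hy', hq.r_iff y hy x (by omega)]

/-- The pair `x`, `y` is contained in no infinite chain or antichain of an order below `q`: either
it is comparable and one element is isolated, or it is incomparable and one element is not. -/
def Killed (q : Cond) (x y : ℕ) : Prop :=
  ((q.r x y ∨ q.r y x) ∧ ((¬ q.sm x ∧ ¬ q.lg x) ∨ (¬ q.sm y ∧ ¬ q.lg y))) ∨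
    (¬ q.r x y ∧ ¬ q.r y x ∧ (q.sm x ∨ q.lg x ∨ q.sm y ∨ q.lg y))

theorem Killed.symm {q : Cond} {x y : ℕ} (h : Killed q x y) : Killed q y x := by
  unfold Killed at *; tauto

theorem Killed.not_solution {G X : Set ℕ} {q : Cond} (hG : Below G q) {x y : ℕ} (hx : x < q.n)
    (hy : y < q.n) (hxy : x ≠ y) (hk : Killed q x y) (hxX : x ∈ X) (hyX : y ∈ X) :
    ¬ (InfChain G X ∨ InfAntichain G X) := by
  rintro (⟨hinf, hc⟩ | ⟨hinf, hc⟩) <;> obtain ⟨z, hz, hqz⟩ := hinf.exists_gt q.n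
  · have h1 : OrderRel G x y ∨ OrderRel G y x := hc hxX hyX hxy
    have h2 : OrderRel G x z ∨ OrderRel G z x := hc hxX hz (by omega)
    have h3 : OrderRel G y z ∨ OrderRel G z y := hc hyX hz (by omega)
    rw [hG.r_iff x hx y hy, hG.r_iff y hy x hx] at h1
    rw [hG.sm_iff x hx z hqz.le, hG.lg_iff x hx z hqz.le] at h2
    rw [hG.sm_iff y hy z hqz.le, hG.lg_iff y hy z hqz.le] at h3
    unfold Killed at hk; tauto
  · have h1 : ¬ OrderRel G x y := hc hxX hyX hxy
    have h1' : ¬ OrderRel G y x := hc hyX hxX hxy.symm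
    have h2 : ¬ OrderRel G x z := hc hxX hz (by omega)
    have h2' : ¬ OrderRel G z x := hc hz hxX (by omega)
    have h3 : ¬ OrderRel G y z := hc hyX hz (by omega)
    have h3' : ¬ OrderRel G z y := hc hz hyX (by omega)
    rw [hG.r_iff x hx y hy] at h1
    rw [hG.r_iff y hy x hx] at h1'
    rw [hG.sm_iff x hx z hqz.le] at h2
    rw [hG.lg_iff x hx z hqz.le] at h2'
    rw [hG.sm_iff y hy z hqz.le] at h3
    rw [hG.lg_iff y hy z hqz.le] at h3'
    unfold Killed at hk; tauto

/-- New labels for the elements of `q` not in `p`: those below some element of `U` become small,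
all others isolated. -/
def relabelSmall {q p : Cond} (h : Ext q p) (U : ℕ → Prop) : Cond where
  n := q.n
  r := q.r
  sm x := (x < p.n ∧ p.sm x) ∨ (p.n ≤ x ∧ ∃ u < q.n, p.n ≤ u ∧ U u ∧ q.r x u)
  lg x := x < p.n ∧ p.lg x
  refl := q.refl
  antisymm := q.antisymm
  trans := q.trans
  sm_down := by
    obtain ⟨a1, a2, a3, a4, a5, a6⟩ := h
    have := p.sm_down; have := q.trans; have := p.disj
    intro x hx y hy hxy
    rintro (⟨h1, h2⟩ | ⟨h1, u, hu, hu', h2, h3⟩)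
    · grind
    · by_cases hxp : x < p.n
      · left; grind
      · right; exact ⟨by omega, u, hu, hu', h2, q.trans x hx y hy u hu hxy h3⟩
  lg_up := by
    obtain ⟨a1, a2, a3, a4, a5, a6⟩ := h
    have := p.lg_up; have := p.disj; grind
  sm_lg := by
    obtain ⟨a1, a2, a3, a4, a5, a6⟩ := h
    have := p.sm_lg; grind
  disj := by have := p.disj; grind

/-- New labels for the elements of `q` not in `p`: those above some element of `U` become large,
all others isolated. -/
def relabelLarge {q p : Cond} (h : Ext q p) (U : ℕ → Prop) : Cond where
  n := q.n
  r := q.r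
  sm x := x < p.n ∧ p.sm x
  lg x := (x < p.n ∧ p.lg x) ∨ (p.n ≤ x ∧ ∃ u < q.n, p.n ≤ u ∧ U u ∧ q.r u x)
  refl := q.refl
  antisymm := q.antisymm
  trans := q.trans
  lg_up := by
    obtain ⟨a1, a2, a3, a4, a5, a6⟩ := h
    have := p.lg_up; have := q.trans; have := p.disj
    intro x hx y hy hxy
    rintro (⟨h1, h2⟩ | ⟨h1, u, hu, hu', h2, h3⟩)
    · grind
    · by_cases hyp : y < p.n
      · left; grind
      · right; exact ⟨by omega, u, hu, hu', h2, q.trans u hu x hx y hy h3 hxy⟩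
  sm_down := by
    obtain ⟨a1, a2, a3, a4, a5, a6⟩ := h
    have := p.sm_down; have := p.disj; grind
  sm_lg := by
    obtain ⟨a1, a2, a3, a4, a5, a6⟩ := h
    have := p.sm_lg; grind
  disj := by have := p.disj; grind

theorem ext_relabelSmall {q p : Cond} (h : Ext q p) (U : ℕ → Prop) : Ext (relabelSmall h U) p where
  le := h.le
  r_iff := h.r_iff
  sm_iff x hx := by simp [relabelSmall, hx]
  lg_iff x hx := by simp [relabelSmall, hx]
  new_sm := h.new_sm
  new_lg := h.new_lg

theorem ext_relabelLarge {q p : Cond} (h : Ext q p) (U : ℕ → Prop) : Ext (relabelLarge h U) p where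
  le := h.le
  r_iff := h.r_iff
  sm_iff x hx := by simp [relabelLarge, hx]
  lg_iff x hx := by simp [relabelLarge, hx]
  new_sm := h.new_sm
  new_lg := h.new_lg

/-- A comparable pair `x ≤ x'` and an incomparable pair `y`, `y'` of new elements can be killed
together: unless `x' ≤ y`, making `y` small leaves `x'` isolated, and in that case making `y` large
leaves `x` isolated. This is where all three limit behaviours are needed. -/
theorem exists_relabel_mixed {q p : Cond} (h : Ext q p) {x x' y y' : ℕ}
    (hx : x < q.n) (hx' : x' < q.n) (hy : y < q.n) (px : p.n ≤ x) (px' : p.n ≤ x')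
    (py : p.n ≤ y) (hne : x ≠ x') (hr : q.r x x') (hyy : ¬ q.r y y') (hyy' : ¬ q.r y' y) :
    ∃ q', Ext q' p ∧ q'.n = q.n ∧ q'.r = q.r ∧ Killed q' x x' ∧ Killed q' y y' := by
  by_cases hxy : q.r x' y
  · refine ⟨relabelLarge h (· = y), ext_relabelLarge h _, rfl, rfl, .inl ⟨.inl hr, .inl ?_⟩,
      .inr ⟨hyy, hyy', .inr (.inl (.inr ⟨py, y, hy, py, rfl, q.refl y hy⟩))⟩⟩
    -- `y ≤ x` would give `x ≤ x' ≤ y ≤ x` and collapse the pair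
    have : ¬ q.r y x := fun hyx => hne (q.antisymm x hx x' hx' hr
      (q.trans x' hx' y hy x hx hxy hyx))
    simp only [relabelLarge]
    grind
  · refine ⟨relabelSmall h (· = y), ext_relabelSmall h _, rfl, rfl, .inl ⟨.inl hr, .inr ?_⟩,
      .inr ⟨hyy, hyy', .inl (.inr ⟨py, y, hy, py, rfl, q.refl y hy⟩)⟩⟩
    simp only [relabelSmall]
    grind

/-- Any two pairs of new elements can be killed together by relabelling. -/
theorem exists_relabel {q p : Cond} (h : Ext q p) {x x' y y' : ℕ}
    (hx : x < q.n) (hx' : x' < q.n) (hy : y < q.n) (hy' : y' < q.n) (px : p.n ≤ x)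
    (px' : p.n ≤ x') (py : p.n ≤ y) (py' : p.n ≤ y') (hne : x ≠ x') (hne' : y ≠ y') :
    ∃ q', Ext q' p ∧ q'.n = q.n ∧ q'.r = q.r ∧ Killed q' x x' ∧ Killed q' y y' := by
  -- two comparable pairs: all new elements isolated; two incomparable pairs: all new elements small
  by_cases cx : q.r x x' ∨ q.r x' x <;> by_cases cy : q.r y y' ∨ q.r y' y
  · refine ⟨relabelSmall h (fun _ => False), ext_relabelSmall h _, rfl, rfl, .inl ⟨cx, .inl ?_⟩,
      .inl ⟨cy, .inl ?_⟩⟩ <;> simp only [relabelSmall] <;> grind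
  · rcases cx with cx | cx
    · exact exists_relabel_mixed h hx hx' hy px px' py hne cx (fun h => cy (.inl h))
        (fun h => cy (.inr h))
    · obtain ⟨q', h1, h2, h3, h4, h5⟩ := exists_relabel_mixed h hx' hx hy px' px py hne.symm cx
        (fun h => cy (.inl h)) (fun h => cy (.inr h))
      exact ⟨q', h1, h2, h3, h4.symm, h5⟩
  · rcases cy with cy | cy
    · obtain ⟨q', h1, h2, h3, h4, h5⟩ := exists_relabel_mixed h hy hy' hx py py' px hne' cy
        (fun h => cx (.inl h)) (fun h => cx (.inr h))
      exact ⟨q', h1, h2, h3, h5, h4⟩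
    · obtain ⟨q', h1, h2, h3, h4, h5⟩ := exists_relabel_mixed h hy' hy hx py' py px hne'.symm cy
        (fun h => cx (.inl h)) (fun h => cx (.inr h))
      exact ⟨q', h1, h2, h3, h5, h4.symm⟩
  · exact ⟨relabelSmall h (fun _ => True), ext_relabelSmall h _, rfl, rfl,
      .inr ⟨fun h => cx (.inl h), fun h => cx (.inr h),
        .inl (.inr ⟨px, x, hx, px, trivial, q.refl x hx⟩)⟩,
      .inr ⟨fun h => cy (.inl h), fun h => cy (.inr h),
        .inl (.inr ⟨py, y, hy, py, trivial, q.refl y hy⟩)⟩⟩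

/-- The empty condition. -/
def Cond.empty : Cond where
  n := 0
  r _ _ := False
  sm _ := False
  lg _ := False
  refl := by simp
  antisymm := by simp
  trans := by simp
  sm_down := by simp
  lg_up := by simp
  sm_lg := by simp
  disj := by simp

/-- `G` meets or avoids the set `W` of conditions. -/
def Decides (G : Set ℕ) (W : Set Cond) : Prop :=
  (∃ q ∈ W, Below G q) ∨ ∃ p, Below G p ∧ ∀ q, Ext q p → q ∉ W

open Classical in
/-- A descending sequence of conditions: step `k` enters `W k` if possible, and then adds one new
element so that the fields exhaust `ℕ`. -/
noncomputable def genSeq (W : ℕ → Set Cond) : ℕ → Cond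
  | 0 => Cond.empty
  | k + 1 => if h : ∃ q ∈ W k, Ext q (genSeq W k) then h.choose.succ else (genSeq W k).succ

theorem genSeq_ext_succ (W : ℕ → Set Cond) (k : ℕ) : Ext (genSeq W (k + 1)) (genSeq W k) := by
  rw [genSeq]
  split_ifs with h
  · exact (Cond.ext_succ _).trans h.choose_spec.2
  · exact Cond.ext_succ _

theorem genSeq_ext (W : ℕ → Set Cond) {k l : ℕ} (h : k ≤ l) : Ext (genSeq W l) (genSeq W k) := by
  induction l, h using Nat.le_induction with
  | base => exact Ext.rfl
  | succ l _ ih => exact (genSeq_ext_succ W l).trans ih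

theorem le_genSeq_n (W : ℕ → Set Cond) (k : ℕ) : k ≤ (genSeq W k).n := by
  induction k with
  | zero => exact Nat.zero_le _
  | succ k ih =>
    rw [genSeq]
    split_ifs with h
    · exact Nat.succ_le_succ (ih.trans h.choose_spec.2.le)
    · exact Nat.succ_le_succ ih

/-- Every countable family of sets of conditions has a generic order. -/
theorem exists_generic {ι : Type*} [Countable ι] [Nonempty ι] (W : ι → Set Cond) :
    ∃ G : Set ℕ, CodesPartialOrder G ∧ (∀ m, ∃ q : Cond, m ≤ q.n ∧ Below G q) ∧
      ∀ i, Decides G (W i) := by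
  obtain ⟨e, he⟩ := exists_surjective_nat ι
  set s := genSeq fun k => W (e k) with hs
  -- both coordinates of the pair coded by `m` are at most `m`, hence in the field at stage `m + 1`
  let G : Set ℕ := {m | (s (m + 1)).r m.unpair.1 m.unpair.2}
  have hle : ∀ k, k ≤ (s k).n := le_genSeq_n _
  have hext : ∀ {k l}, k ≤ l → Ext (s l) (s k) := fun h => genSeq_ext _ h
  have hG : ∀ k, ∀ x < (s k).n, ∀ y < (s k).n, (OrderRel G x y ↔ (s k).r x y) := by
    intro k x hx y hy
    have h1 := Nat.left_le_pair x y
    have h2 := Nat.right_le_pair x y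
    have h3 := hle (Nat.pair x y + 1)
    have h0 : OrderRel G x y ↔ (s (Nat.pair x y + 1)).r x y := by
      simp only [OrderRel, G, Set.mem_ofPred_eq, Nat.unpair_pair]
    rw [h0]
    rcases le_total k (Nat.pair x y + 1) with h | h
    · exact (hext h).r_iff x hx y hy
    · exact ((hext h).r_iff x (by omega) y (by omega)).symm
  have below_of : ∀ k q, Ext (s k) q → Below G q := by
    intro k q hq
    refine ⟨fun x hx y hy => ?_, fun x hx y hy => ?_, fun x hx y hy => ?_⟩
    · rw [hG k x (hx.trans_le hq.le) y (hy.trans_le hq.le), hq.r_iff x hx y hy]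
    all_goals
      have h1 := hle (max k (y + 1))
      have h2 := (hext (le_max_left k (y + 1))).trans hq
      have h3 := h2.le
      have h4 := le_max_right k (y + 1)
    · rw [hG (max k (y + 1)) x (by omega) y (by omega)]
      exact h2.new_sm x hx y (by omega) hy
    · rw [hG (max k (y + 1)) y (by omega) x (by omega)]
      exact h2.new_lg x hx y (by omega) hy
  refine ⟨G, ⟨fun x => ?_, fun x y => ?_, fun x y z => ?_⟩, fun m => ⟨s m, hle m,
    below_of m _ Ext.rfl⟩, fun i => ?_⟩
  · have := hle (x + 1)
    rw [hG (x + 1) x (by omega) x (by omega)]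
    exact (s (x + 1)).refl x (by omega)
  · have := hle (x + y + 1)
    rw [hG (x + y + 1) x (by omega) y (by omega), hG (x + y + 1) y (by omega) x (by omega)]
    exact (s (x + y + 1)).antisymm x (by omega) y (by omega)
  · have := hle (x + y + z + 1)
    rw [hG (x + y + z + 1) x (by omega) y (by omega), hG (x + y + z + 1) y (by omega) z (by omega),
      hG (x + y + z + 1) x (by omega) z (by omega)]
    exact (s (x + y + z + 1)).trans x (by omega) y (by omega) z (by omega)
  · obtain ⟨k, rfl⟩ := he i
    by_cases h : ∃ q ∈ W (e k), Ext q (s k)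
    · refine .inl ⟨h.choose, h.choose_spec.1, below_of (k + 1) _ ?_⟩
      have : s (k + 1) = h.choose.succ := dif_pos h
      rw [this]
      exact Cond.ext_succ _
    · exact .inr ⟨s k, below_of k _ Ext.rfl, fun q hq hW => h ⟨q, hW, hq⟩⟩

theorem weaklyStableOrder_of_below {G : Set ℕ} (h : CodesPartialOrder G)
    (hG : ∀ m, ∃ q : Cond, m ≤ q.n ∧ Below G q) : WeaklyStableOrder G := by
  refine ⟨h, fun x => ?_⟩
  obtain ⟨q, hq, hb⟩ := hG (x + 1)
  have hev : ∀ᶠ y in Filter.cofinite, q.n ≤ y :=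
    (Set.finite_Iio q.n).subset fun y hy => Set.mem_Iio.2 (not_le.1 hy)
  by_cases hs : q.sm x
  · exact .inl (hev.mono fun y hy => (hb.sm_iff x (by omega) y hy).2 hs)
  by_cases hl : q.lg x
  · exact .inr (.inr (hev.mono fun y hy => (hb.lg_iff x (by omega) y hy).2 hl))
  · exact .inr (.inl (hev.mono fun y hy => ⟨fun h => hs ((hb.sm_iff x (by omega) y hy).1 h),
      fun h => hl ((hb.lg_iff x (by omega) y hy).1 h)⟩))

/-! ### Strings for joins and the generic order -/

instance : Inhabited EnumOp where
  default :=
    { rel := fun _ _ => False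
      primrec := PrimrecPred.of_eq (Primrec.eq.comp (Primrec.const 0) (Primrec.const 1))
        (fun _ => by simp)
      mono := fun _ h => h }

theorem EnumOp.exists_stage (Φ : EnumOp) {Y s : Set ℕ} (hs : s.Finite) (h : s ⊆ Φ.enum Y) :
    ∃ K, ∀ k ≥ K, ∀ x ∈ s, Φ.rel (pref Y k) x :=
  Filter.eventually_atTop.1 <| (Filter.eventually_all_finite hs).2 fun x hx => by
    obtain ⟨k, hk⟩ := h hx
    exact Filter.eventually_atTop.2 ⟨k, fun l hl => Φ.rel_pref_mono hl hk⟩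

/-- The finite oracle string for `join X Y` obtained from strings for `X` and `Y`. -/
def joinStr (σ τ : List Bool) : List Bool :=
  (List.range (2 * min σ.length τ.length)).map fun i =>
    if i % 2 = 0 then σ.getD (i / 2) false else τ.getD (i / 2) false

theorem primrec_joinStr : Primrec₂ joinStr := by
  refine Primrec.list_map (Primrec.list_range.comp (Primrec.nat_mul.comp (Primrec.const 2)
    (Primrec.nat_min.comp (Primrec.list_length.comp Primrec.fst)
      (Primrec.list_length.comp Primrec.snd)))) ?_
  have hi : Primrec fun z : (List Bool × List Bool) × ℕ => z.2 / 2 :=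
    Primrec.nat_div.comp Primrec.snd (Primrec.const 2)
  exact Primrec.ite (Primrec.eq.comp (Primrec.nat_mod.comp Primrec.snd (Primrec.const 2))
    (Primrec.const 0)) ((Primrec.list_getD false).comp (Primrec.fst.comp Primrec.fst) hi)
    ((Primrec.list_getD false).comp (Primrec.snd.comp Primrec.fst) hi)

open Classical in
theorem getD_pref (Y : Set ℕ) {k i : ℕ} (h : i < k) :
    (pref Y k).getD i false = decide (i ∈ Y) := by
  rw [List.getD_eq_getElem?_getD, getElem?_pref, if_pos h, Option.getD_some]

theorem getD_pref_eq_true {Y : Set ℕ} {k i : ℕ} :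
    (pref Y k).getD i false = true ↔ i < k ∧ i ∈ Y := by
  rw [List.getD_eq_getElem?_getD, getElem?_pref]
  by_cases h : i < k <;> simp [h]

theorem joinStr_pref (X Y : Set ℕ) (k l : ℕ) :
    joinStr (pref X k) (pref Y l) = pref (join X Y) (2 * min k l) := by
  classical
  rw [joinStr, length_pref, length_pref]
  conv_rhs => rw [pref]
  refine List.map_congr_left fun i hi => ?_
  rw [List.mem_range] at hi
  rw [getD_pref X (by omega), getD_pref Y (by omega)]
  by_cases h : i % 2 = 0 <;> simp [mem_join, h]

/-- The finite set with characteristic string `τ`. -/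
def ofStr (τ : List Bool) : Set ℕ := {i | τ.getD i false = true}

theorem pref_ofStr (τ : List Bool) : pref (ofStr τ) τ.length = τ := by
  refine List.ext_getElem? fun i => ?_
  rw [getElem?_pref]
  by_cases h : i < τ.length
  · simp [h, ofStr]
  · simp [h]

theorem rel_joinStr_mono (Φ : EnumOp) {X : Set ℕ} {τ : List Bool} {k l x : ℕ} (h : k ≤ l)
    (hx : Φ.rel (joinStr (pref X k) τ) x) : Φ.rel (joinStr (pref X l) τ) x := by
  rw [← pref_ofStr τ, joinStr_pref] at hx ⊢
  exact Φ.rel_pref_mono (by omega) hx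

theorem mem_enum_join_of_rel (Φ : EnumOp) {X Y : Set ℕ} {τ : List Bool} {k x : ℕ}
    (hY : pref Y τ.length = τ) (hx : Φ.rel (joinStr (pref X k) τ) x) : x ∈ Φ.enum (join X Y) := by
  rw [← hY, joinStr_pref] at hx
  exact ⟨_, hx⟩

/-- An infinite set enumerated from `join X Y` shows two elements beyond a given bound on
sufficiently long strings. -/
theorem exists_pair_joinStr (Φ : EnumOp) {X Y : Set ℕ} (h : (Φ.enum (join X Y)).Infinite) (b : ℕ) :
    ∃ x x', x ≠ x' ∧ b ≤ x ∧ b ≤ x' ∧ ∃ K, ∀ k ≥ K, ∀ l ≥ K,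
      Φ.rel (joinStr (pref X k) (pref Y l)) x ∧ Φ.rel (joinStr (pref X k) (pref Y l)) x' := by
  obtain ⟨x, hx, hbx⟩ := h.exists_gt b
  obtain ⟨x', hx', hxx'⟩ := h.exists_gt x
  obtain ⟨K, hK⟩ := hx
  obtain ⟨K', hK'⟩ := hx'
  refine ⟨x, x', hxx'.ne, hbx.le, (hbx.trans hxx').le, max K K', fun k hk l hl => ?_⟩
  rw [joinStr_pref]
  exact ⟨Φ.rel_pref_mono (by omega) hK, Φ.rel_pref_mono (by omega) hK'⟩

/-- The oracle string decided by a condition with field `{x | x < n}` and order `r`: a condition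
decides exactly the codes below `n * n`. -/
noncomputable def condStr (n : ℕ) (r : ℕ → ℕ → Prop) : List Bool :=
  pref {m | r m.unpair.1 m.unpair.2} (n * n)

theorem Below.condStr_eq {G : Set ℕ} {q : Cond} (h : Below G q) :
    condStr q.n q.r = pref G (q.n * q.n) := by
  classical
  refine List.map_congr_left fun m hm => ?_
  rw [List.mem_range] at hm
  have h0 := Nat.max_sq_add_min_le_pair m.unpair.1 m.unpair.2
  rw [Nat.pair_unpair] at h0
  have h1 : max m.unpair.1 m.unpair.2 ^ 2 < q.n ^ 2 :=
    ((Nat.le_add_right _ _).trans h0).trans_lt (hm.trans_eq (sq _).symm)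
  have h2 := lt_of_pow_lt_pow_left₀ 2 (Nat.zero_le _) h1
  have h3 := h.r_iff m.unpair.1 ((le_max_left _ _).trans_lt h2) m.unpair.2
    ((le_max_right _ _).trans_lt h2)
  rw [OrderRel, Nat.pair_unpair] at h3
  simp [h3]

/-- `τ` extends `c`, and `σ` shows that all new elements of `τ` are below `e` in the order
enumerated by `Ψ`. -/
def LowerExt (Ψ : EnumOp) (c σ : List Bool) (e : ℕ) (τ : List Bool) : Prop :=
  τ.take c.length = c ∧
    ∀ i < τ.length, c.length ≤ i → τ.getD i false = true → Ψ.rel σ (Nat.pair i e)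

/-- `τ` extends `c`, and `σ` shows that all new elements of `τ` are above `e` in the order
enumerated by `Ψ`. -/
def UpperExt (Ψ : EnumOp) (c σ : List Bool) (e : ℕ) (τ : List Bool) : Prop :=
  τ.take c.length = c ∧
    ∀ i < τ.length, c.length ≤ i → τ.getD i false = true → Ψ.rel σ (Nat.pair e i)

theorem LowerExt.mono {Ψ : EnumOp} {c σ σ' τ : List Bool} {e : ℕ} (h : LowerExt Ψ c σ e τ)
    (hσ : σ <+: σ') : LowerExt Ψ c σ' e τ :=
  ⟨h.1, fun i hi hc ht => Ψ.mono hσ (h.2 i hi hc ht)⟩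

theorem UpperExt.mono {Ψ : EnumOp} {c σ σ' τ : List Bool} {e : ℕ} (h : UpperExt Ψ c σ e τ)
    (hσ : σ <+: σ') : UpperExt Ψ c σ' e τ :=
  ⟨h.1, fun i hi hc ht => Ψ.mono hσ (h.2 i hi hc ht)⟩

theorem primrec_lowerExt (Ψ : EnumOp) (c : List Bool) :
    PrimrecPred fun x : List Bool × ℕ × List Bool => LowerExt Ψ c x.1 x.2.1 x.2.2 := by
  have hτ : Primrec fun x : List Bool × ℕ × List Bool => x.2.2 := Primrec.snd.comp Primrec.snd
  refine PrimrecPred.and (Primrec.eq.comp (Primrec.list_take.comp (Primrec.const _) hτ)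
    (Primrec.const _)) ?_
  have h1 : PrimrecRel fun (i : ℕ) (x : List Bool × ℕ × List Bool) =>
      ¬ c.length ≤ i ∨ ¬ x.2.2.getD i false = true ∨ Ψ.rel x.1 (Nat.pair i x.2.1) := by
    refine (PrimrecPred.not (Primrec.nat_le.comp (Primrec.const _) Primrec.fst)).or
      ((PrimrecPred.not (Primrec.eq.comp ((Primrec.list_getD false).comp (hτ.comp Primrec.snd)
        Primrec.fst) (Primrec.const true))).or (Ψ.primrec.comp (Primrec.fst.comp Primrec.snd)
        (Primrec₂.natPair.comp Primrec.fst (Primrec.fst.comp (Primrec.snd.comp Primrec.snd)))))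
  refine (h1.forall_mem_list.comp (Primrec.list_range.comp (Primrec.list_length.comp hτ))
    Primrec.id).of_eq fun x => ?_
  simp only [List.mem_range, id]
  refine forall₂_congr fun i _ => ?_
  tauto

/-- The conditions that decide a computation of `Φ` containing a killed pair. -/
def singleSet (Φ : EnumOp) : Set Cond :=
  {q | ∃ x x', x < q.n ∧ x' < q.n ∧ x ≠ x' ∧ Killed q x x' ∧
    Φ.rel (condStr q.n q.r) x ∧ Φ.rel (condStr q.n q.r) x'}

/-- The conditions that decide an element `e`, an extension of `c` by elements below `e` on which
`Φ` enumerates a killed pair, and an extension of `a` by elements above `e` on which `Φ'` enumerates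
a killed pair. -/
def diagSet (Ψ Φ Φ' : EnumOp) (c a : List Bool) : Set Cond :=
  {q | ∃ e τ η, LowerExt Ψ c (condStr q.n q.r) e τ ∧ UpperExt Ψ a (condStr q.n q.r) e η ∧
    (∃ x x', x < q.n ∧ x' < q.n ∧ x ≠ x' ∧ Killed q x x' ∧
      Φ.rel (joinStr (condStr q.n q.r) τ) x ∧ Φ.rel (joinStr (condStr q.n q.r) τ) x') ∧
    ∃ y y', y < q.n ∧ y' < q.n ∧ y ≠ y' ∧ Killed q y y' ∧
      Φ'.rel (joinStr (condStr q.n q.r) η) y ∧ Φ'.rel (joinStr (condStr q.n q.r) η) y'}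

/-- A sufficiently generic order. -/
structure IsGeneric (G : Set ℕ) : Prop where
  order : CodesPartialOrder G
  below : ∀ m, ∃ q : Cond, m ≤ q.n ∧ Below G q
  single : ∀ Φ, Decides G (singleSet Φ)
  diag : ∀ Ψ Φ Φ' c a, Decides G (diagSet Ψ Φ Φ' c a)

theorem exists_isGeneric : ∃ G, IsGeneric G := by
  obtain ⟨G, h1, h2, h3⟩ := exists_generic
    (ι := EnumOp ⊕ EnumOp × EnumOp × EnumOp × List Bool × List Bool)
    (Sum.elim singleSet fun x => diagSet x.1 x.2.1 x.2.2.1 x.2.2.2.1 x.2.2.2.2)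
  exact ⟨G, h1, h2, fun Φ => h3 (.inl Φ), fun Ψ Φ Φ' c a => h3 (.inr (Ψ, Φ, Φ', c, a))⟩

theorem IsGeneric.computesNoSolution {G : Set ℕ} (hG : IsGeneric G) : ComputesNoSolution G G := by
  intro S hS hc
  obtain ⟨Φ, -, rfl, -⟩ := hc.exists_enum
  rcases hG.single Φ with ⟨q, ⟨x, x', hx, hx', hne, hk, h1, h2⟩, hq⟩ | ⟨p, hp, havoid⟩
  · rw [hq.condStr_eq] at h1 h2
    exact hk.not_solution (X := Φ.enum G) hq hx hx' hne ⟨_, h1⟩ ⟨_, h2⟩ hS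
  · have hinf : (Φ.enum G).Infinite := hS.elim (·.1) (·.1)
    obtain ⟨x, hx, hbx⟩ := hinf.exists_gt p.n
    obtain ⟨x', hx', hxx'⟩ := hinf.exists_gt x
    obtain ⟨k, hk⟩ := hx
    obtain ⟨k', hk'⟩ := hx'
    obtain ⟨q, hqn, hq⟩ := hG.below (p.n + x' + k + k' + 1)
    have hsq : q.n ≤ q.n * q.n := Nat.le_mul_self _
    -- an extension of `p` in the set it avoids: the same computation, with the pair killed
    obtain ⟨q', h1, h2, h3, h4, -⟩ := exists_relabel (hp.ext hq (by omega)) (x := x) (x' := x')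
      (y := x) (y' := x') (by omega) (by omega) (by omega) (by omega) (by omega) (by omega)
      (by omega) (by omega) hxx'.ne hxx'.ne
    refine havoid q' h1 ⟨x, x', by omega, by omega, hxx'.ne, h4, ?_, ?_⟩ <;>
      rw [h2, h3, hq.condStr_eq]
    · exact Φ.rel_pref_mono (by omega) hk
    · exact Φ.rel_pref_mono (by omega) hk'

/-! ### Defeating one pair of operators -/

/-- The transitive relation coded by `Q`, enumerated from `G` by `Ψ`, has only small and isolated
elements, and every infinite set enumerated from `G` contains a small one. -/
structure IsTame (G : Set ℕ) (Ψ : EnumOp) (Q : Set ℕ) : Prop where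
  enum_eq : Ψ.enum G = Q
  trans : ∀ x y z, OrderRel Q x y → OrderRel Q y z → OrderRel Q x z
  stable : ∀ x, IsSmall (OrderRel Q) x ∨ IsIsolated (OrderRel Q) x
  immune : ∀ Φ : EnumOp, (Φ.enum G).Infinite → ∃ e ∈ Φ.enum G, IsSmall (OrderRel Q) e

theorem IsSmall.not_isIsolated {r : ℕ → ℕ → Prop} {x : ℕ} (h : IsSmall r x) :
    ¬ IsIsolated r x := fun h' => by
  obtain ⟨y, hy, hy'⟩ := (Filter.Eventually.and h h').exists
  exact hy'.1 hy

theorem IsTame.isSmall_of_le {G Q : Set ℕ} {Ψ : EnumOp} (h : IsTame G Ψ Q) {x y : ℕ}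
    (hxy : OrderRel Q x y) (hy : IsSmall (OrderRel Q) y) : IsSmall (OrderRel Q) x :=
  Filter.Eventually.mono hy fun _ hz => h.trans _ _ _ hxy hz

theorem IsTame.isIsolated_of_le {G Q : Set ℕ} {Ψ : EnumOp} (h : IsTame G Ψ Q) {x y : ℕ}
    (hxy : OrderRel Q x y) (hx : IsIsolated (OrderRel Q) x) : IsIsolated (OrderRel Q) y :=
  (h.stable y).resolve_left fun hy => (h.isSmall_of_le hxy hy).not_isIsolated hx

/-- If `e` is small, then so are the elements below it, hence all elements of a lower extension. -/
theorem LowerExt.isSmall {G Q : Set ℕ} {Ψ : EnumOp} (h : IsTame G Ψ Q) {c τ : List Bool}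
    {e k : ℕ} (hτ : LowerExt Ψ c (pref G k) e τ) (he : IsSmall (OrderRel Q) e)
    (hc : ∀ i ∈ ofStr c, IsSmall (OrderRel Q) i) : ∀ i ∈ ofStr τ, IsSmall (OrderRel Q) i := by
  intro i hi
  by_cases hic : i < c.length
  · refine hc i ?_
    rw [ofStr, Set.mem_ofPred_eq, List.getD_eq_getElem?_getD] at hi ⊢
    rwa [← hτ.1, List.getElem?_take_of_lt hic]
  · have hiτ : i < τ.length := by
      by_contra hlt
      simp [ofStr, List.getElem?_eq_none (not_lt.1 hlt)] at hi
    refine h.isSmall_of_le (y := e) ?_ he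
    rw [OrderRel, ← h.enum_eq]
    exact ⟨k, hτ.2 i hiτ (not_lt.1 hic) hi⟩

/-- If `e` is isolated, then so are the elements above it, hence all elements of an upper
extension. -/
theorem UpperExt.isIsolated {G Q : Set ℕ} {Ψ : EnumOp} (h : IsTame G Ψ Q) {c τ : List Bool}
    {e k : ℕ} (hτ : UpperExt Ψ c (pref G k) e τ) (he : IsIsolated (OrderRel Q) e)
    (hc : ∀ i ∈ ofStr c, IsIsolated (OrderRel Q) i) :
    ∀ i ∈ ofStr τ, IsIsolated (OrderRel Q) i := by
  intro i hi
  by_cases hic : i < c.length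
  · refine hc i ?_
    rw [ofStr, Set.mem_ofPred_eq, List.getD_eq_getElem?_getD] at hi ⊢
    rwa [← hτ.1, List.getElem?_take_of_lt hic]
  · have hiτ : i < τ.length := by
      by_contra hlt
      simp [ofStr, List.getElem?_eq_none (not_lt.1 hlt)] at hi
    refine h.isIsolated_of_le (x := e) ?_ he
    rw [OrderRel, ← h.enum_eq]
    exact ⟨k, hτ.2 i hiτ (not_lt.1 hic) hi⟩

/-- The string `c` guarantees that an infinite set beginning with `c`, all of whose elements satisfy
`p`, enumerates no solution of `G` through `Φ`, jointly with `G`. -/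
def Secures (G : Set ℕ) (p : ℕ → Prop) (Φ : EnumOp) (c : List Bool) : Prop :=
  ∀ C : Set ℕ, C.Infinite → (∀ i ∈ C, p i) → pref C c.length = c →
    ¬ (InfChain G (Φ.enum (join G C)) ∨ InfAntichain G (Φ.enum (join G C)))

theorem secures_of_killed {G : Set ℕ} {q : Cond} (hq : Below G q) {Φ : EnumOp} {τ : List Bool}
    {x x' : ℕ} (hx : x < q.n) (hx' : x' < q.n) (hne : x ≠ x') (hk : Killed q x x')
    (h1 : Φ.rel (joinStr (condStr q.n q.r) τ) x) (h2 : Φ.rel (joinStr (condStr q.n q.r) τ) x')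
    (p : ℕ → Prop) : Secures G p Φ τ := by
  intro C _ _ hC
  rw [hq.condStr_eq] at h1 h2
  exact hk.not_solution hq hx hx' hne (mem_enum_join_of_rel Φ hC h1)
    (mem_enum_join_of_rel Φ hC h2)

/-- The elements `e` above an extension of `c` that makes `Φ` enumerate two elements beyond `b`. -/
theorem exists_enum_lowerExt (Ψ Φ : EnumOp) (c : List Bool) (b : ℕ) :
    ∃ Θ : EnumOp, ∀ G : Set ℕ, ∀ e, e ∈ Θ.enum G ↔ ∃ k τ x x', LowerExt Ψ c (pref G k) e τ ∧
      x ≠ x' ∧ b ≤ x ∧ b ≤ x' ∧ Φ.rel (joinStr (pref G k) τ) x ∧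
        Φ.rel (joinStr (pref G k) τ) x' := by
  obtain ⟨Θ, hΘ⟩ := exists_enum_of_witness (β := List Bool × ℕ × ℕ)
    (K := fun σ e w => LowerExt Ψ c σ e w.1 ∧ w.2.1 ≠ w.2.2 ∧ b ≤ w.2.1 ∧ b ≤ w.2.2 ∧
      Φ.rel (joinStr σ w.1) w.2.1 ∧ Φ.rel (joinStr σ w.1) w.2.2) (by
    have hσ : Primrec fun z : List Bool × ℕ × List Bool × ℕ × ℕ => z.1 := Primrec.fst
    have he : Primrec fun z : List Bool × ℕ × List Bool × ℕ × ℕ => z.2.1 :=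
      Primrec.fst.comp Primrec.snd
    have hw : Primrec fun z : List Bool × ℕ × List Bool × ℕ × ℕ => z.2.2 :=
      Primrec.snd.comp Primrec.snd
    have hτ := Primrec.fst.comp hw
    have hx := Primrec.fst.comp (Primrec.snd.comp hw)
    have hx' := Primrec.snd.comp (Primrec.snd.comp hw)
    have hj := primrec_joinStr.comp hσ hτ
    refine ((primrec_lowerExt Ψ c).comp (hσ.pair (he.pair hτ))).and
      ((Primrec.eq.comp hx hx').not.and ((Primrec.nat_le.comp (Primrec.const b) hx).and
      ((Primrec.nat_le.comp (Primrec.const b) hx').and ((Φ.primrec.comp hj hx).and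
        (Φ.primrec.comp hj hx')))))
    )
  refine ⟨Θ, fun G e => ?_⟩
  rw [hΘ]
  simp only [Set.mem_ofPred_eq, Prod.exists]

/-- If only finitely many `e` bound an extension of `c` on which `Φ` enumerates two elements beyond
`b`, then `Φ` enumerates a finite set from every infinite set of small elements beginning with `c`:
finitely many small elements are below almost every `e`. -/
theorem secures_of_finite {G Q : Set ℕ} {Ψ Φ : EnumOp} (hQ : IsTame G Ψ Q)
    {c : List Bool} {b : ℕ} (hfin : {e | ∃ k τ x x', LowerExt Ψ c (pref G k) e τ ∧ x ≠ x' ∧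
      b ≤ x ∧ b ≤ x' ∧ Φ.rel (joinStr (pref G k) τ) x ∧ Φ.rel (joinStr (pref G k) τ) x'}.Finite) :
    Secures G (IsSmall (OrderRel Q)) Φ c := by
  intro C _ hCs hC hsol
  obtain ⟨x, x', hne, hbx, hbx', K, hK⟩ :=
    exists_pair_joinStr Φ (hsol.elim (·.1) (·.1)) b
  set l := max K c.length
  have hCfin : (C ∩ Set.Iio l).Finite := (Set.finite_Iio l).subset Set.inter_subset_right
  have hev : ∀ᶠ e in Filter.cofinite, ∀ i ∈ C ∩ Set.Iio l, OrderRel Q i e :=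
    (Filter.eventually_all_finite hCfin).2 fun i hi => hCs i hi.1
  obtain ⟨e, he, he'⟩ := (hev.and hfin.eventually_cofinite_notMem).exists
  obtain ⟨K', hK'⟩ := Ψ.exists_stage (Y := G)
    (s := (fun i => Nat.pair i e) '' (C ∩ Set.Iio l)) (hCfin.image _) (by
      rintro _ ⟨i, hi, rfl⟩
      rw [hQ.enum_eq]
      exact he i hi)
  obtain ⟨h1, h2⟩ := hK (max K K') (le_max_left _ _) l (le_max_left _ _)
  refine he' ⟨max K K', pref C l, x, x', ⟨?_, fun i hi _ ht => ?_⟩, hne, hbx, hbx', h1, h2⟩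
  · rw [take_pref C (le_max_right _ _), hC]
  · rw [getD_pref_eq_true] at ht
    exact hK' _ (le_max_right _ _) _ ⟨i, ⟨ht.2, ht.1⟩, rfl⟩

/-- If almost all numbers are above `e`, but no extension of `a` by elements above `e` makes `Φ`
enumerate two elements beyond `b`, then padding `a` with zeros forces `Φ` to enumerate a finite
set. -/
theorem secures_append {G Q : Set ℕ} {Ψ Φ : EnumOp} (hQ : IsTame G Ψ Q) {a : List Bool}
    {b e N : ℕ} (hN : ∀ i ≥ N, OrderRel Q e i)
    (hno : ¬ ∃ k η y y', UpperExt Ψ a (pref G k) e η ∧ y ≠ y' ∧ b ≤ y ∧ b ≤ y' ∧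
      Φ.rel (joinStr (pref G k) η) y ∧ Φ.rel (joinStr (pref G k) η) y') (p : ℕ → Prop) :
    Secures G p Φ (a ++ List.replicate N false) := by
  intro A _ _ hA hsol
  obtain ⟨y, y', hne, hby, hby', K, hK⟩ :=
    exists_pair_joinStr Φ (hsol.elim (·.1) (·.1)) b
  rw [List.length_append, List.length_replicate] at hA
  have hlow : ∀ i ∈ A, a.length ≤ i → N ≤ i := by
    intro i hi hai
    by_contra hlt
    have h1 : (pref A (a.length + N)).getD i false = true :=
      getD_pref_eq_true.2 ⟨by omega, hi⟩
    rw [hA, List.getD_append_right _ _ _ _ hai, List.getD_replicate _ (by omega)] at h1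
    exact Bool.false_ne_true h1
  set l := max K (a.length + N)
  have hAfin : (A ∩ Set.Ico a.length l).Finite :=
    (Set.finite_Ico _ l).subset Set.inter_subset_right
  obtain ⟨K', hK'⟩ := Ψ.exists_stage (Y := G)
    (s := (fun i => Nat.pair e i) '' (A ∩ Set.Ico a.length l)) (hAfin.image _) (by
      rintro _ ⟨i, hi, rfl⟩
      rw [hQ.enum_eq]
      exact hN i (hlow i hi.1 hi.2.1))
  obtain ⟨h1, h2⟩ := hK (max K K') (le_max_left _ _) l (le_max_left _ _)
  refine hno ⟨max K K', pref A l, y, y', ⟨?_, fun i hi hai ht => ?_⟩, hne, hby, hby', h1, h2⟩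
  · have : (pref A l).take (a.length + N) = _ := take_pref A (le_max_right K _)
    rw [hA] at this
    have h3 := congrArg (List.take a.length) this
    rwa [List.take_take, min_eq_left (by omega), List.take_left] at h3
  · rw [getD_pref_eq_true] at ht
    exact hK' _ (le_max_right _ _) _ ⟨i, ⟨ht.2, hai, ht.1⟩, rfl⟩

theorem ofStr_append_replicate (a : List Bool) (N : ℕ) :
    ofStr (a ++ List.replicate N false) = ofStr a := by
  ext i
  simp only [ofStr, Set.mem_ofPred_eq, List.getD_eq_getElem?_getD, List.getElem?_append,
    List.getElem?_replicate]
  by_cases h : i < a.length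
  · simp [h]
  · by_cases h' : i - a.length < N <;> simp [h, h']

/-- One requirement: either the string for the small elements can be extended so as to defeat `Φ`,
or the string for the isolated elements can be extended so as to defeat `Φ'`. -/
theorem exists_secures {G Q : Set ℕ} {Ψ : EnumOp} (hG : IsGeneric G) (hQ : IsTame G Ψ Q)
    (Φ Φ' : EnumOp) {c a : List Bool} (hc : ∀ i ∈ ofStr c, IsSmall (OrderRel Q) i)
    (ha : ∀ i ∈ ofStr a, IsIsolated (OrderRel Q) i) :
    (∃ c', c <+: c' ∧ (∀ i ∈ ofStr c', IsSmall (OrderRel Q) i) ∧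
      Secures G (IsSmall (OrderRel Q)) Φ c') ∨
    (∃ a', a <+: a' ∧ (∀ i ∈ ofStr a', IsIsolated (OrderRel Q) i) ∧
      Secures G (IsIsolated (OrderRel Q)) Φ' a') := by
  rcases hG.diag Ψ Φ Φ' c a with ⟨q, ⟨e, τ, η, hτ, hη, ⟨x, x', hx, hx', hne, hk, h1, h2⟩,
    ⟨y, y', hy, hy', hne', hk', h1', h2'⟩⟩, hq⟩ | ⟨p, hp, havoid⟩
  · have hτ' := hτ
    have hη' := hη
    rw [hq.condStr_eq] at hτ' hη'
    -- both pairs are killed, so whichever way `e` behaves in the limit, one extension is legitimate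
    rcases hQ.stable e with he | he
    · exact .inl ⟨τ, List.prefix_iff_eq_take.2 hτ.1.symm, hτ'.isSmall hQ he hc,
        secures_of_killed hq hx hx' hne hk h1 h2 _⟩
    · exact .inr ⟨η, List.prefix_iff_eq_take.2 hη.1.symm, hη'.isIsolated hQ he ha,
        secures_of_killed hq hy hy' hne' hk' h1' h2' _⟩
  obtain ⟨Θ, hΘ⟩ := exists_enum_lowerExt Ψ Φ c p.n
  by_cases hfin : (Θ.enum G).Finite
  · refine .inl ⟨c, List.prefix_rfl, hc, secures_of_finite hQ (b := p.n) ?_⟩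
    rwa [Set.ext (hΘ G)] at hfin
  obtain ⟨e, he, hes⟩ := hQ.immune Θ hfin
  obtain ⟨k, τ, x, x', hτ, hne, hpx, hpx', h1, h2⟩ := (hΘ G e).1 he
  by_cases hup : ∃ k η y y', UpperExt Ψ a (pref G k) e η ∧ y ≠ y' ∧ p.n ≤ y ∧ p.n ≤ y' ∧
      Φ'.rel (joinStr (pref G k) η) y ∧ Φ'.rel (joinStr (pref G k) η) y'
  · -- both computations exist, so relabelling their pairs gives an extension of `p` in the set
    -- that `p` avoids
    exfalso
    obtain ⟨k', η, y, y', hη, hne', hpy, hpy', h1', h2'⟩ := hup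
    obtain ⟨q, hqn, hq⟩ := hG.below (p.n + x + x' + y + y' + k + k' + 1)
    have hsq : q.n ≤ q.n * q.n := Nat.le_mul_self _
    obtain ⟨q', g1, g2, g3, g4, g5⟩ := exists_relabel (hp.ext hq (by omega)) (x := x) (x' := x')
      (y := y) (y' := y') (by omega) (by omega) (by omega) (by omega) hpx hpx' hpy hpy' hne hne'
    refine havoid q' g1 ⟨e, τ, η, ?_, ?_, ⟨x, x', by omega, by omega, hne, g4, ?_, ?_⟩,
      ⟨y, y', by omega, by omega, hne', g5, ?_, ?_⟩⟩ <;> rw [g2, g3, hq.condStr_eq]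
    · exact hτ.mono (pref_prefix G (by omega))
    · exact hη.mono (pref_prefix G (by omega))
    · exact rel_joinStr_mono Φ (by omega) h1
    · exact rel_joinStr_mono Φ (by omega) h2
    · exact rel_joinStr_mono Φ' (by omega) h1'
    · exact rel_joinStr_mono Φ' (by omega) h2'
  · obtain ⟨N, hN⟩ : ∃ N, ∀ i ≥ N, OrderRel Q e i := by
      rw [IsSmall, Nat.cofinite_eq_atTop] at hes
      exact Filter.eventually_atTop.1 hes
    exact .inr ⟨_, List.prefix_append _ _, by rwa [ofStr_append_replicate],
      secures_append hQ hN hup _⟩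

/-! ### Construction of the chain and the antichain -/

theorem Secures.of_prefix {G : Set ℕ} {p : ℕ → Prop} {Φ : EnumOp} {c c' : List Bool}
    (h : Secures G p Φ c) (hc : c <+: c') : Secures G p Φ c' := by
  intro C hinf hCp hC
  refine h C hinf hCp ?_
  rw [← take_pref C hc.length_le, hC]
  exact (List.prefix_iff_eq_take.1 hc).symm

/-- A string can be extended by one further element satisfying `p`. -/
theorem exists_append_true {p : ℕ → Prop} (hp : {x | p x}.Infinite) {c : List Bool}
    (hc : ∀ i ∈ ofStr c, p i) :
    ∃ c', c <+: c' ∧ (∀ i ∈ ofStr c', p i) ∧ ∃ i ∈ ofStr c', c.length ≤ i := by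
  obtain ⟨s, hs, hcs⟩ := hp.exists_gt c.length
  have hlen : (c ++ List.replicate (s - c.length) false).length = s := by simp; omega
  have key : ∀ i, i ∈ ofStr (c ++ List.replicate (s - c.length) false ++ [true]) ↔
      i ∈ ofStr c ∨ i = s := by
    intro i
    rw [← ofStr_append_replicate c (s - c.length)]
    rcases lt_trichotomy i s with h | rfl | h
    · simp only [ofStr, Set.mem_ofPred_eq, List.getD_eq_getElem?_getD]
      rw [List.getElem?_append_left (by omega)]
      simp [h.ne]
    · simp only [ofStr, Set.mem_ofPred_eq, List.getD_eq_getElem?_getD]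
      rw [List.getElem?_append_right (by omega), hlen]
      simp
    · simp only [ofStr, Set.mem_ofPred_eq, List.getD_eq_getElem?_getD]
      rw [List.getElem?_eq_none (by simp; omega), List.getElem?_eq_none (by omega)]
      simp [h.ne']
  refine ⟨_, (List.prefix_append _ _).trans (List.prefix_append _ _), fun i hi => ?_, s,
    (key s).2 (.inr rfl), hcs.le⟩
  rcases (key i).1 hi with hi | rfl
  · exact hc i hi
  · exact hs

/-- The set whose characteristic function extends every string of the sequence `c`. -/
def limitSet (c : ℕ → List Bool) : Set ℕ := {i | ∃ k, i ∈ ofStr (c k)}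

theorem pref_limitSet {c : ℕ → List Bool} (hc : ∀ k, c k <+: c (k + 1)) (k : ℕ) :
    pref (limitSet c) (c k).length = c k := by
  have hmono : ∀ {k l}, k ≤ l → c k <+: c l := by
    intro k l h
    induction l, h using Nat.le_induction with
    | base => exact List.prefix_rfl
    | succ l _ ih => exact ih.trans (hc l)
  conv_rhs => rw [← pref_ofStr (c k)]
  refine List.map_congr_left fun i hi => ?_
  rw [List.mem_range] at hi
  have : i ∈ limitSet c ↔ i ∈ ofStr (c k) := by
    refine ⟨fun ⟨l, hl⟩ => ?_, fun h => ⟨k, h⟩⟩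
    simp only [ofStr, Set.mem_ofPred_eq, List.getD_eq_getElem?_getD] at hl ⊢
    rcases le_total k l with h | h
    · obtain ⟨ρ, hρ⟩ := hmono h
      rwa [← hρ, List.getElem?_append_left hi] at hl
    · obtain ⟨ρ, hρ⟩ := hmono h
      by_cases hil : i < (c l).length
      · rwa [← hρ, List.getElem?_append_left hil]
      · simp [List.getElem?_eq_none (not_lt.1 hil)] at hl
  simp [this]

theorem infinite_limitSet {c : ℕ → List Bool}
    (h : ∀ k, ∃ i ∈ ofStr (c (k + 1)), (c k).length ≤ i) : (limitSet c).Infinite := by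
  have hlen : ∀ k, k ≤ (c k).length := by
    intro k
    induction k with
    | zero => exact Nat.zero_le _
    | succ k ih =>
      obtain ⟨i, hi, hki⟩ := h k
      by_contra hlt
      rw [ofStr, Set.mem_ofPred_eq, List.getD_eq_getElem?_getD,
        List.getElem?_eq_none (by omega)] at hi
      exact Bool.false_ne_true hi
  refine Set.infinite_of_not_bddAbove fun ⟨b, hb⟩ => ?_
  obtain ⟨i, hi, hki⟩ := h (b + 1)
  have := hb ⟨b + 2, hi⟩
  have := hlen (b + 1)
  omega

/-- An infinite set of small elements and an infinite set of isolated elements, at least one of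
which enumerates no solution of `G`, jointly with `G`. -/
theorem exists_small_isolated {G Q : Set ℕ} {Ψ : EnumOp} (hG : IsGeneric G) (hQ : IsTame G Ψ Q)
    (hS : {x | IsSmall (OrderRel Q) x}.Infinite) (hI : {x | IsIsolated (OrderRel Q) x}.Infinite) :
    ∃ C A : Set ℕ, C.Infinite ∧ A.Infinite ∧ (∀ i ∈ C, IsSmall (OrderRel Q) i) ∧
      (∀ i ∈ A, IsIsolated (OrderRel Q) i) ∧
      (ComputesNoSolution (join G C) G ∨ ComputesNoSolution (join G A) G) := by
  have step : ∀ (r : EnumOp × EnumOp) (s : List Bool × List Bool),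
      ((∀ i ∈ ofStr s.1, IsSmall (OrderRel Q) i) ∧ ∀ i ∈ ofStr s.2, IsIsolated (OrderRel Q) i) →
      ∃ s' : List Bool × List Bool,
        ((∀ i ∈ ofStr s'.1, IsSmall (OrderRel Q) i) ∧
          ∀ i ∈ ofStr s'.2, IsIsolated (OrderRel Q) i) ∧ s.1 <+: s'.1 ∧ s.2 <+: s'.2 ∧
        (∃ i ∈ ofStr s'.1, s.1.length ≤ i) ∧ (∃ i ∈ ofStr s'.2, s.2.length ≤ i) ∧
        (Secures G (IsSmall (OrderRel Q)) r.1 s'.1 ∨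
          Secures G (IsIsolated (OrderRel Q)) r.2 s'.2) := by
    rintro ⟨Φ, Φ'⟩ ⟨c, a⟩ ⟨hc, ha⟩
    rcases exists_secures hG hQ Φ Φ' hc ha with ⟨c₁, h1, h2, h3⟩ | ⟨a₁, h1, h2, h3⟩
    · obtain ⟨c', k1, k2, i, hi, hci⟩ := exists_append_true hS h2
      obtain ⟨a', l1, l2, l3⟩ := exists_append_true hI ha
      exact ⟨(c', a'), ⟨k2, l2⟩, h1.trans k1, l1, ⟨i, hi, h1.length_le.trans hci⟩, l3,
        .inl (h3.of_prefix k1)⟩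
    · obtain ⟨a', k1, k2, i, hi, hci⟩ := exists_append_true hI h2
      obtain ⟨c', l1, l2, l3⟩ := exists_append_true hS hc
      exact ⟨(c', a'), ⟨l2, k2⟩, l1, h1.trans k1, l3, ⟨i, hi, h1.length_le.trans hci⟩,
        .inr (h3.of_prefix k1)⟩
  obtain ⟨e, he⟩ := exists_surjective_nat (EnumOp × EnumOp)
  choose! f hf using step
  let s : ℕ → List Bool × List Bool := fun k => Nat.rec ([], []) (fun k s => f (e k) s) k
  have hs : ∀ k, (∀ i ∈ ofStr (s k).1, IsSmall (OrderRel Q) i) ∧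
      ∀ i ∈ ofStr (s k).2, IsIsolated (OrderRel Q) i := by
    intro k
    induction k with
    | zero => constructor <;> intro i hi <;> simp [s, ofStr] at hi
    | succ k ih => exact (hf (e k) (s k) ih).1
  have hs' := fun k => (hf (e k) (s k) (hs k)).2
  have hC : (limitSet fun k => (s k).1).Infinite := infinite_limitSet fun k => (hs' k).2.2.1
  have hA : (limitSet fun k => (s k).2).Infinite := infinite_limitSet fun k => (hs' k).2.2.2.1
  have hCs : ∀ i ∈ limitSet fun k => (s k).1, IsSmall (OrderRel Q) i :=
    fun i ⟨k, hk⟩ => (hs k).1 i hk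
  have hAs : ∀ i ∈ limitSet fun k => (s k).2, IsIsolated (OrderRel Q) i :=
    fun i ⟨k, hk⟩ => (hs k).2 i hk
  refine ⟨_, _, hC, hA, hCs, hAs, ?_⟩
  -- solutions computed on both sides would be enumerated by some `Φ` and `Φ'`, contrary to the
  -- requirement for that pair
  by_contra! hcon
  simp only [ComputesNoSolution] at hcon
  push Not at hcon
  obtain ⟨⟨X, hX, hXC⟩, ⟨Y, hY, hYA⟩⟩ := hcon
  obtain ⟨Φ, -, rfl, -⟩ := hXC.exists_enum
  obtain ⟨Φ', -, rfl, -⟩ := hYA.exists_enum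
  obtain ⟨k, hk⟩ := he (Φ, Φ')
  have h := (hs' k).2.2.2.2
  rw [hk] at h
  rcases h with h | h
  · refine h _ hC hCs ?_ hX
    have := pref_limitSet (c := fun k => (s k).1) (fun k => (hs' k).1) (k + 1)
    simp only [s, hk] at this ⊢
    exact this
  · refine h _ hA hAs ?_ hY
    have := pref_limitSet (c := fun k => (s k).2) (fun k => (hs' k).2.1) (k + 1)
    simp only [s, hk] at this ⊢
    exact this

/-- From an infinite set of small elements an infinite chain can be computed. -/
theorem exists_chain_of_small {Z Q : Set ℕ} (hQ : ComputableFrom Q Z) (Φ : EnumOp)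
    (hinf : (Φ.enum Z).Infinite) (hs : ∀ x ∈ Φ.enum Z, IsSmall (OrderRel Q) x) :
    ∃ S, InfChain Q S ∧ ComputableFrom S Z := by
  obtain ⟨Θ, -, hΘ, -⟩ := hQ.exists_enum
  obtain ⟨S, -, hSinf, hSc, hS⟩ := exists_thin Φ Θ hinf (by rw [hΘ]; exact hs)
  rw [hΘ] at hS
  refine ⟨S, ⟨hSinf, fun x hx y hy hne => ?_⟩, hSc⟩
  rcases hne.lt_or_gt with h | h
  · exact .inl (hS x hx y hy h)
  · exact .inr (hS y hy x hx h)

/-- From an infinite set of isolated elements an infinite antichain can be computed. -/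
theorem exists_antichain_of_isolated {Z Q : Set ℕ} (hQ : ComputableFrom Q Z) (Φ : EnumOp)
    (hinf : (Φ.enum Z).Infinite) (hs : ∀ x ∈ Φ.enum Z, IsIsolated (OrderRel Q) x) :
    ∃ S, InfAntichain Q S ∧ ComputableFrom S Z := by
  obtain ⟨-, Ψ, -, hΨ⟩ := hQ.exists_enum
  let Θ : EnumOp :=
    { rel := fun σ m => Ψ.rel σ m ∧ Ψ.rel σ (Nat.pair m.unpair.2 m.unpair.1)
      primrec := PrimrecPred.and Ψ.primrec (Ψ.primrec.comp Primrec.fst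
        (Primrec₂.natPair.comp (Primrec.snd.comp (Primrec.unpair.comp Primrec.snd))
          (Primrec.fst.comp (Primrec.unpair.comp Primrec.snd))))
      mono := fun h hx => ⟨Ψ.mono h hx.1, Ψ.mono h hx.2⟩ }
  have hΘ : ∀ x y, Nat.pair x y ∈ Θ.enum Z ↔ ¬ OrderRel Q x y ∧ ¬ OrderRel Q y x := by
    intro x y
    have h : ∀ x y, ¬ OrderRel Q x y ↔ Nat.pair x y ∈ Ψ.enum Z := fun x y => by rw [hΨ]; rfl
    rw [h, h]
    constructor
    · rintro ⟨k, hk⟩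
      simp only [Θ, Nat.unpair_pair] at hk
      exact ⟨⟨k, hk.1⟩, ⟨k, hk.2⟩⟩
    · rintro ⟨⟨k, hk⟩, ⟨l, hl⟩⟩
      refine ⟨max k l, Ψ.rel_pref_mono (le_max_left _ _) hk, ?_⟩
      simp only [Nat.unpair_pair]
      exact Ψ.rel_pref_mono (le_max_right _ _) hl
  obtain ⟨S, -, hSinf, hSc, hS⟩ := exists_thin Φ Θ hinf (by simp only [hΘ]; exact hs)
  refine ⟨S, ⟨hSinf, fun x hx y hy hne => ?_⟩, hSc⟩
  rcases hne.lt_or_gt with h | h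
  · exact ((hΘ x y).1 (hS x hx y hy h)).1
  · exact ((hΘ y x).1 (hS y hy x hx h)).2

theorem exists_enum_Ici (N : ℕ) : ∃ Φ : EnumOp, ∀ Y, Φ.enum Y = Set.Ici N :=
  ⟨⟨fun _ x => N ≤ x, Primrec.nat_le.comp (Primrec.const N) Primrec.snd, fun _ h => h⟩,
    fun Y => by ext x; simp [EnumOp.enum]⟩

/-- A `G`-computable order of small and isolated elements without `G`-computable solutions has a
chain and an antichain one of which does not help `G` to solve itself. -/
theorem exists_chain_antichain_of_small_or_isolated {G Q : Set ℕ} (hG : IsGeneric G)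
    (htrans : ∀ x y z, OrderRel Q x y → OrderRel Q y z → OrderRel Q x z)
    (hst : ∀ x, IsSmall (OrderRel Q) x ∨ IsIsolated (OrderRel Q) x) (hQG : ComputableFrom Q G)
    (hno : ComputesNoSolution G Q) :
    ∃ C A : Set ℕ, InfChain Q C ∧ InfAntichain Q A ∧
      (ComputesNoSolution (join G C) G ∨ ComputesNoSolution (join G A) G) := by
  obtain ⟨Ψ, -, hΨ, -⟩ := hQG.exists_enum
  have himm : ∀ Φ : EnumOp, (Φ.enum G).Infinite → ∃ e ∈ Φ.enum G, IsSmall (OrderRel Q) e := by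
    intro Φ hΦ
    by_contra! hcon
    obtain ⟨S, hS, hSc⟩ := exists_antichain_of_isolated hQG Φ hΦ
      fun x hx => (hst x).resolve_left (hcon x hx)
    exact hno S (.inr hS) hSc
  have hS : {x | IsSmall (OrderRel Q) x}.Infinite := by
    refine Set.infinite_of_not_bddAbove fun ⟨b, hb⟩ => ?_
    obtain ⟨Φ, hΦ⟩ := exists_enum_Ici (b + 1)
    obtain ⟨e, he, hes⟩ := himm Φ (by rw [hΦ]; exact Set.Ici_infinite _)
    rw [hΦ] at he
    exact absurd (hb hes) (not_le.2 he)
  have hI : {x | IsIsolated (OrderRel Q) x}.Infinite := by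
    refine Set.infinite_of_not_bddAbove fun ⟨b, hb⟩ => ?_
    obtain ⟨Φ, hΦ⟩ := exists_enum_Ici (b + 1)
    obtain ⟨S, hS, hSc⟩ := exists_chain_of_small hQG Φ (by rw [hΦ]; exact Set.Ici_infinite _)
      fun x hx => (hst x).resolve_right fun h => by
        rw [hΦ] at hx
        exact absurd (hb h) (not_le.2 hx)
    exact hno S (.inl hS) hSc
  obtain ⟨C, A, hC, hA, hCs, hAs, hCA⟩ :=
    exists_small_isolated hG ⟨hΨ, htrans, hst, himm⟩ hS hI
  obtain ⟨Φ, -, hΦ, -⟩ := (computableFrom_join_right G C).exists_enum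
  obtain ⟨Φ', -, hΦ', -⟩ := (computableFrom_join_right G A).exists_enum
  obtain ⟨C', hC', hCC'⟩ := exists_chain_of_small (hQG.trans (computableFrom_join_left G C)) Φ
    (by rwa [hΦ]) (by rwa [hΦ])
  obtain ⟨A', hA', hAA'⟩ := exists_antichain_of_isolated
    (hQG.trans (computableFrom_join_left G A)) Φ' (by rwa [hΦ']) (by rwa [hΦ'])
  exact ⟨C', A', hC', hA', hCA.imp
    (fun h S hS hc => h S hS (hc.trans ((computableFrom_join_left G C).join hCC')))
    (fun h S hS hc => h S hS (hc.trans ((computableFrom_join_left G A).join hAA')))⟩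

/-- The reverse of a coded relation. -/
def reverse (X : Set ℕ) : Set ℕ := (fun m => Nat.pair m.unpair.2 m.unpair.1) ⁻¹' X

theorem orderRel_reverse {X : Set ℕ} {x y : ℕ} : OrderRel (reverse X) x y ↔ OrderRel X y x := by
  simp [OrderRel, reverse]

theorem computableFrom_reverse {X Y : Set ℕ} (h : ComputableFrom X Y) :
    ComputableFrom (reverse X) Y :=
  h.comp (Primrec₂.natPair.comp (Primrec.snd.comp Primrec.unpair)
    (Primrec.fst.comp Primrec.unpair))

theorem infChain_reverse {X S : Set ℕ} : InfChain (reverse X) S ↔ InfChain X S := by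
  simp only [InfChain, IsChain, Set.Pairwise, orderRel_reverse, or_comm]

theorem infAntichain_reverse {X S : Set ℕ} : InfAntichain (reverse X) S ↔ InfAntichain X S := by
  refine and_congr_right fun _ => ⟨fun h x hx y hy hne => ?_, fun h x hx y hy hne => ?_⟩
  · have : ¬ OrderRel (reverse X) y x := h hy hx hne.symm
    rwa [orderRel_reverse] at this
  · have : ¬ OrderRel X y x := h hy hx hne.symm
    rwa [← orderRel_reverse] at this

/-- The case of large and isolated elements reduces to that of small and isolated elements by
reversing the order. -/
theorem IsGeneric.exists_chain_antichain {G P : Set ℕ} (hG : IsGeneric G) (hP : StableOrder P)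
    (hPG : ComputableFrom P G) (hno : ComputesNoSolution G P) :
    ∃ C A : Set ℕ, InfChain P C ∧ InfAntichain P A ∧
      (ComputesNoSolution (join G C) G ∨ ComputesNoSolution (join G A) G) := by
  obtain ⟨⟨-, -, htrans⟩, hst | hst⟩ := hP
  · exact exists_chain_antichain_of_small_or_isolated hG htrans hst hPG hno
  · obtain ⟨C, A, hC, hA, h⟩ := exists_chain_antichain_of_small_or_isolated (Q := reverse P) hG
      (fun x y z hxy hyz => by
        rw [orderRel_reverse] at *
        exact htrans z y x hyz hxy)
      (fun x => by
        simp only [IsSmall, IsIsolated, orderRel_reverse]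
        exact (hst x).imp id fun h => h.mono fun _ => And.symm)
      (computableFrom_reverse hPG)
      (fun S hS => hno S (by rwa [infChain_reverse, infAntichain_reverse] at hS))
    exact ⟨C, A, infChain_reverse.1 hC, infAntichain_reverse.1 hA, h⟩

end ChainAntichain

theorem mainTheorem2 :
    ¬ ChainAntichain.ComputablyReducible ChainAntichain.WSCAC ChainAntichain.SCAC ∧
    ∃ G : Set ℕ, ChainAntichain.WeaklyStableOrder G ∧
      ChainAntichain.ComputesNoSolution G G ∧
      ∀ P : Set ℕ, ChainAntichain.StableOrder P → ChainAntichain.ComputableFrom P G →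
        ChainAntichain.ComputesNoSolution G P →
        ∃ C A : Set ℕ, ChainAntichain.InfChain P C ∧ ChainAntichain.InfAntichain P A ∧
          (ChainAntichain.ComputesNoSolution (ChainAntichain.join G C) G ∨
            ChainAntichain.ComputesNoSolution (ChainAntichain.join G A) G) := by
  obtain ⟨G, hG⟩ := ChainAntichain.exists_isGeneric
  have hws := ChainAntichain.weaklyStableOrder_of_below hG.order hG.below
  refine ⟨fun hred => ?_, G, hws, hG.computesNoSolution,
    fun P hP hPG hno => hG.exists_chain_antichain hP hPG hno⟩
  obtain ⟨P, hP, hPG, hsol⟩ := hred G hws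
  by_cases hno : ChainAntichain.ComputesNoSolution G P
  · obtain ⟨C, A, hC, hA, h | h⟩ := hG.exists_chain_antichain hP hPG hno
    · obtain ⟨Y, hY, hYc⟩ := hsol C (.inl hC)
      exact h Y hY hYc
    · obtain ⟨Y, hY, hYc⟩ := hsol A (.inr hA)
      exact h Y hY hYc
  · -- a `G`-computable solution of `P` would make `G` compute a solution of itself
    simp only [ChainAntichain.ComputesNoSolution] at hno
    push Not at hno
    obtain ⟨S, hS, hSG⟩ := hno
    obtain ⟨Y, hY, hYc⟩ := hsol S hS
    exact hG.computesNoSolution Y hY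
      (hYc.trans (ChainAntichain.ComputableFrom.join (TuringReducible.refl _) hSG))
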